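/- Let $w=p/q$ with $p,q$ relatively prime integers, $0<p<q$, and let $N\ge k\ge 2$ be integers. Let $\Pi$ be a homogeneous Poisson point process of intensity $\lambda>0$ on $(0,1]$ and $M=|\Pi|$ its number of points. For a finite multiset $A\subset(0,1]$ put $S_w(A)=\max_{0\le t\le 1-w}|A\cap(t,t+w]|$, points being counted with multiplicity, and $S_w=S_w(\Pi)$. Define $$\nu(\Pi)=\sum_{Q\in\Pi,\ Q<1-w}\mathbf 1\bigl\{S_w<k,\ |\Pi\cap(Q,Q+w]|=k-2,\ |\Pi\cap(t,t+w]|\le k-2\text{ for all }t\in[Q,Q+w]\bigr\},$$ $$\tilde\nu(\Pi)=\sum_{Q\in\Pi}\mathbf 1\bigl\{S_w<k,\ S_w(\Pi\cup\{Q\})=k\bigr\},$$ where in $\Pi\cup\{Q\}$ the point $Q$ has multiplicity $2$. For $j\in\{N-1,N\}$ let $\gamma^{(j)}=\mathbb P(S_w\ge k\mid M=j)$. For $n=mq$, $m=1,2,\dots$, with $n\ge N$, choose $N$ of the $n$ cells $1,\dots,n$ uniformly at random, let $J_i^n\in\{0,1\}$ indicate whether cell $i$ is chosen, and let $$\gamma_n^{(N)}=\mathbb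 P\Bigl(\max_{1\le i\le n-nw+1}\ \sum_{r=i}^{i+nw-1}J_r^n\ge k\Bigr).$$ Theorem 3.1. The random variable $\nu(\Pi)+\tilde\nu(\Pi)$ is integrable conditionally on $M=N-1$, and as $n\to\infty$ through the multiples of $q$, $$n\bigl(\gamma^{(N)}-\gamma_n^{(N)}\bigr)\longrightarrow \tfrac12 N(N-1)\bigl(\gamma^{(N-1)}-\gamma^{(N)}\bigr)+\tfrac12 N\,\mathbb E\bigl[\nu(\Pi)+\tilde\nu(\Pi)\mid M=N-1\bigr].$$ -/

import Mathlib

open MeasureTheory ProbabilityTheory Filter Topology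
open scoped NNReal

namespace ScanStatistic

open Classical in
/-- The number of points, counted with multiplicity, of a finite multiset of reals in a set. -/
noncomputable def numPoints (s : Multiset ℝ) (B : Set ℝ) : ℕ :=
  s.countP (fun x => x ∈ B)

/-- `Pt` is a homogeneous Poisson point process of intensity `lam` on `(0, 1]`: a random finite
subset of `(0, 1]` whose numbers of points in Borel sets are Poisson distributed random variables
with mean `lam` times the Lebesgue measure, independent over pairwise disjoint sets. -/
structure IsPoissonProcess {Ω : Type*} [MeasurableSpace Ω] (P : Measure Ω) (lam : ℝ≥0)
    (Pt : Ω → Finset ℝ) : Prop where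
  subset_Ioc : ∀ ω, (Pt ω : Set ℝ) ⊆ Set.Ioc 0 1
  measurable_numPoints : ∀ B : Set ℝ, MeasurableSet B →
    Measurable (fun ω => numPoints (Pt ω).val B)
  map_numPoints : ∀ B : Set ℝ, MeasurableSet B → B ⊆ Set.Ioc 0 1 →
    P.map (fun ω => numPoints (Pt ω).val B) = poissonMeasure (lam * (volume B).toNNReal)
  iIndepFun_numPoints : ∀ (r : ℕ) (B : Fin r → Set ℝ), (∀ i, MeasurableSet (B i)) →
    Pairwise (fun i j => Disjoint (B i) (B j)) →
    iIndepFun (fun i ω => numPoints (Pt ω).val (B i)) P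

/-- The continuous scan statistic: the maximal number of points, counted with multiplicity, in a
window `(t, t + w]` with `0 ≤ t ≤ 1 - w`. The supremum is over a set of natural numbers that is
bounded by the total number of points, so for `w ≤ 1` it is a maximum. -/
noncomputable def scanStat (w : ℝ) (s : Multiset ℝ) : ℕ :=
  sSup ((fun t => numPoints s (Set.Ioc t (t + w))) '' Set.Icc 0 (1 - w))

open Classical in
/-- The functional `ν` (for `k ≥ 2`): the number of points `Q` of `π` below `1 - w` such that the
scan statistic is less than `k`, the window `(Q, Q + w]` holds exactly `k - 2` points, and
`(t, t + w]` holds at most `k - 2` points for every `t` in `[Q, Q + w]`. -/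
noncomputable def nu (w : ℝ) (k : ℕ) (π : Finset ℝ) : ℕ :=
  ∑ Q ∈ π with Q < 1 - w,
    if scanStat w π.val < k ∧ numPoints π.val (Set.Ioc Q (Q + w)) = k - 2 ∧
        ∀ t : ℝ, Q ≤ t → t ≤ Q + w → numPoints π.val (Set.Ioc t (t + w)) ≤ k - 2
      then 1 else 0

/-- The functional `ν̃`: the number of points `Q` of `π` such that the scan statistic of `π` is
less than `k` and becomes equal to `k` when `Q` is given multiplicity `2`. -/
noncomputable def nuTilde (w : ℝ) (k : ℕ) (π : Finset ℝ) : ℕ :=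
  ∑ Q ∈ π, if scanStat w π.val < k ∧ scanStat w (Q ::ₘ π.val) = k then 1 else 0

/-- `γ^(N)`: the conditional probability that the scan statistic of the random set `Pt` is at
least `k`, given that `Pt` has `N` points. -/
noncomputable def gamma {Ω : Type*} [MeasurableSpace Ω] (P : Measure Ω) (Pt : Ω → Finset ℝ)
    (w : ℝ) (k N : ℕ) : ℝ :=
  (ProbabilityTheory.cond P {ω | (Pt ω).card = N}).real {ω | k ≤ scanStat w (Pt ω).val}

/-- The discrete scan statistic of a set `J` of cells among the cells `1, …, n`: the maximal
number of cells of `J` among `L` consecutive cells `i, …, i + L - 1`, `1 ≤ i ≤ n - L + 1`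
(for `L ≤ n`). -/
def discreteScanStat (n L : ℕ) (J : Finset ℕ) : ℕ :=
  (Finset.Icc 1 (n - L + 1)).sup (fun i => (J ∩ Finset.Ico i (i + L)).card)

/-- `γ_n^(N)` with windows of `L` cells: the probability that the discrete scan statistic is at
least `k` for a set of `N` of the `n` cells chosen uniformly, i.e. each with probability
`1 / (n.choose N)`. -/
noncomputable def gammaDiscrete (n L k N : ℕ) : ℝ :=
  (((Finset.Icc 1 n).powersetCard N).filter (fun J => k ≤ discreteScanStat n L J)).card /
    (n.choose N : ℝ)

end ScanStatistic

/-!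
Conditionally on `M = N` the points of the Poisson process are `N` independent uniform points, so
the theorem is a statement about such a sample. Let `D` be the event that the `N` points lie in
distinct cells of length `1 / n`; given `D`, the occupied cells form a uniformly chosen set of `N`
cells (`gammaDiscrete_mul`). The scan statistic is at least `k` if and only if there are `k` points
with all mutual distances less than `w`, and the discrete one if and only if there are `k` cells
with all differences of indices less than `n w`. The discrete condition is the stronger one, which
gives `γ^(N) = P(S ≥ k, Dᶜ) + P(D) γ_n^(N) + P(H)` (`measureReal_hasClique_eq`), where `H` is the
event that the cells are distinct and a cluster of `k` points is not seen by the discrete windows.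
Hence `n (γ^(N) - γ_n^(N)) P(D) = n P(S ≥ k, Dᶜ) + n P(H) - γ^(N) n P(Dᶜ)`.

Each event on the right lies in a union of events "point `j` lies exactly `L` cells to the right of
point `i`", with `L = 0` for `Dᶜ` and `L = n w` for `H`. Such an event has a probability of order
`1 / n`, and two of them occur together with probability `o(1 / n)`. After the factor `1 / n` has been
removed (`measure_inter_cell_pair`), the integrand converges for every generic sample, and dominated
convergence yields the limit. For `L = 0` it is the probability that the scan statistic of `N - 1`
points reaches `k` when one of them is counted twice, and this is where `ν̃` comes from. For
`L = n w` the two points are at distance close to `w`, less than `w` with probability `1 / 2`, and the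
cluster hinges on this pair; `critical_pair_iff` identifies the condition with the one in `ν`.

The passage from the Poisson process to the uniform sample goes through order statistics. Their law
is determined by joint counts in finite partitions (`map_sortedTuple_eq`), and these are multinomial
in both cases (`IsPoissonProcess.cond_counts`). The functionals agree with measurable functions of
the order statistics on generic samples, which suffices.
-/

namespace ScanStatistic

/-! ### Clusters and scan statistics -/

/-- A relation `R` has a clique of at least `k` indices. The relation is also required on the
diagonal, which is harmless for the relations used below. -/
def HasClique {ι : Type*} (R : ι → ι → Prop) (k : ℕ) : Prop :=
  ∃ I : Finset ι, k ≤ I.card ∧ ∀ a ∈ I, ∀ b ∈ I, R a b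

lemma HasClique.congr {ι : Type*} {R R' : ι → ι → Prop} {k : ℕ} (h : ∀ a b, R a b ↔ R' a b) :
    HasClique R k ↔ HasClique R' k := by
  have : R = R' := by ext a b; exact h a b
  rw [this]

lemma numPoints_le_card (s : Multiset ℝ) (B : Set ℝ) : numPoints s B ≤ s.card := by
  classical
  exact Multiset.countP_le_card _ _

lemma numPoints_map {ι : Type*} [Fintype ι] (U : ι → ℝ) (B : Set ℝ) [DecidablePred (· ∈ B)] :
    numPoints (Finset.univ.val.map U) B = (Finset.univ.filter fun a => U a ∈ B).card := by
  classical
  unfold numPoints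
  rw [Multiset.countP_map, Finset.card_def, Finset.filter_val]
  congr

lemma numPoints_cons (Q : ℝ) (s : Multiset ℝ) (B : Set ℝ) [Decidable (Q ∈ B)] :
    numPoints (Q ::ₘ s) B = numPoints s B + if Q ∈ B then 1 else 0 := by
  unfold numPoints
  rw [Multiset.countP_cons]
  congr

lemma bddAbove_windows (w : ℝ) (s : Multiset ℝ) :
    BddAbove ((fun t => numPoints s (Set.Ioc t (t + w))) '' Set.Icc 0 (1 - w)) := by
  refine ⟨s.card, ?_⟩
  rintro _ ⟨t, -, rfl⟩
  exact numPoints_le_card _ _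

lemma le_scanStat_iff {w : ℝ} (hw : w ≤ 1) (s : Multiset ℝ) (k : ℕ) :
    k ≤ scanStat w s ↔ ∃ t, 0 ≤ t ∧ t ≤ 1 - w ∧ k ≤ numPoints s (Set.Ioc t (t + w)) := by
  constructor
  · intro h
    have hne : ((fun t => numPoints s (Set.Ioc t (t + w))) '' Set.Icc 0 (1 - w)).Nonempty :=
      ⟨_, 0, ⟨le_rfl, by linarith⟩, rfl⟩
    obtain ⟨t, ht, h2⟩ := Nat.sSup_mem hne (bddAbove_windows w s)
    refine ⟨t, ht.1, ht.2, ?_⟩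
    simp only at h2
    rw [h2]
    exact h
  · rintro ⟨t, h0, h1, h⟩
    exact h.trans (le_csSup (bddAbove_windows w s) ⟨t, ⟨h0, h1⟩, rfl⟩)

lemma scanStat_le_cons {w : ℝ} (hw : w ≤ 1) (Q : ℝ) (s : Multiset ℝ) :
    scanStat w s ≤ scanStat w (Q ::ₘ s) := by
  classical
  obtain ⟨t, h0, h1, h⟩ := (le_scanStat_iff hw s _).1 le_rfl
  refine (le_scanStat_iff hw _ _).2 ⟨t, h0, h1, ?_⟩
  rw [numPoints_cons]
  omega

lemma scanStat_cons_le {w : ℝ} (hw : w ≤ 1) (Q : ℝ) (s : Multiset ℝ) :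
    scanStat w (Q ::ₘ s) ≤ scanStat w s + 1 := by
  classical
  obtain ⟨t, h0, h1, h⟩ := (le_scanStat_iff hw (Q ::ₘ s) _).1 le_rfl
  have := (le_scanStat_iff hw s _).2 ⟨t, h0, h1, le_rfl⟩
  rw [numPoints_cons] at h
  split_ifs at h <;> omega

/-- Only differences of points matter: `k` points of `(0, 1]` lie in an admissible window as soon as
any two of them differ by less than `w`. -/
lemma le_scanStat_map_iff {ι : Type*} [Fintype ι] {w : ℝ} (hw1 : w ≤ 1) {U : ι → ℝ}
    (hU : ∀ i, U i ∈ Set.Ioc (0 : ℝ) 1) (k : ℕ) :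
    k ≤ scanStat w (Finset.univ.val.map U) ↔ HasClique (fun a b => U a < U b + w) k := by
  classical
  rw [le_scanStat_iff hw1]
  constructor
  · rintro ⟨t, h0, h1, h⟩
    rw [numPoints_map] at h
    refine ⟨_, h, ?_⟩
    intro a ha b hb
    simp only [Finset.mem_filter, Set.mem_Ioc] at ha hb
    linarith [ha.2.2, hb.2.1]
  · rintro ⟨I, hk, hI⟩
    rcases I.eq_empty_or_nonempty with rfl | hne
    · exact ⟨0, le_rfl, by linarith, by simpa using (Nat.le_zero.1 hk).le.trans (Nat.zero_le _)⟩
    · obtain ⟨M, hM, hMax⟩ := I.exists_max_image U hne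
      obtain ⟨m, hm, hMin⟩ := I.exists_min_image U hne
      -- The window ends at the largest point, unless it would then start below `0`.
      refine ⟨max 0 (U M - w), le_max_left _ _, max_le (by linarith) (by linarith [(hU M).2]), ?_⟩
      rw [numPoints_map]
      refine hk.trans (Finset.card_le_card ?_)
      intro a ha
      simp only [Finset.mem_filter, Finset.mem_univ, true_and, Set.mem_Ioc]
      refine ⟨max_lt (hU a).1 ?_, ?_⟩
      · linarith [hMin a ha, hI M hM m hm]
      · linarith [hMax a ha, le_max_right 0 (U M - w)]

/-- The discrete counterpart of `le_scanStat_map_iff`: `k` of the cells lie in `L` consecutive cells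
as soon as the indices of any two of them differ by less than `L`. -/
lemma le_discreteScanStat_iff {ι : Type*} [Fintype ι] {n L k : ℕ} (hL : L ≤ n) (hk : 0 < k)
    {c : ι → ℕ} (hc : Function.Injective c) (hcn : ∀ i, c i ∈ Finset.Icc 1 n) :
    k ≤ discreteScanStat n L (Finset.univ.image c) ↔ HasClique (fun a b => c a < c b + L) k := by
  classical
  have key : ∀ i, (Finset.univ.image c ∩ Finset.Ico i (i + L)).card =
      (Finset.univ.filter fun a => c a ∈ Finset.Ico i (i + L)).card := by
    intro i
    rw [← Finset.card_image_of_injective _ hc]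
    congr 1
    ext x
    simp only [Finset.mem_inter, Finset.mem_image, Finset.mem_univ, true_and, Finset.mem_filter]
    constructor
    · rintro ⟨⟨a, rfl⟩, h⟩; exact ⟨a, h, rfl⟩
    · rintro ⟨a, h, rfl⟩; exact ⟨⟨a, rfl⟩, h⟩
  unfold discreteScanStat
  rw [Finset.le_sup_iff (by simpa using hk)]
  constructor
  · rintro ⟨i, -, h⟩
    rw [key] at h
    refine ⟨_, h, ?_⟩
    intro a ha b hb
    simp only [Finset.mem_filter, Finset.mem_Ico] at ha hb
    omega
  · rintro ⟨I, hkI, hI⟩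
    have hne : I.Nonempty := Finset.card_pos.1 (by omega)
    obtain ⟨M, hM, hMax⟩ := I.exists_max_image c hne
    obtain ⟨m, hm, hMin⟩ := I.exists_min_image c hne
    have h1 := hI M hM m hm
    have h2 := Finset.mem_Icc.1 (hcn M)
    have h3 := Finset.mem_Icc.1 (hcn m)
    refine ⟨max 1 (c M + 1 - L), ?_, ?_⟩
    · simp only [Finset.mem_Icc]; omega
    · rw [key]
      refine hkI.trans (Finset.card_le_card ?_)
      intro a ha
      simp only [Finset.mem_filter, Finset.mem_univ, true_and, Finset.mem_Ico]
      have := hMax a ha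
      have := hMin a ha
      omega

/-! ### Generic configurations and critical pairs -/

/-- A configuration in `(0, 1]` without the coincidences at which the scan statistic is
discontinuous: no two points at distance `0`, `w` or `2 w`, and no point at `1 - w`. The value `2 w`
occurs because a point near `U i + w` is compared with the other points. -/
structure Generic {ι : Type*} (w : ℝ) (U : ι → ℝ) : Prop where
  mem_Ioc : ∀ i, U i ∈ Set.Ioc (0 : ℝ) 1
  ne_one_sub : ∀ i, U i ≠ 1 - w
  ne : ∀ a b, a ≠ b → U a ≠ U b
  ne_add : ∀ a b, a ≠ b → U a ≠ U b + w
  ne_add_add : ∀ a b, a ≠ b → U a ≠ U b + w + w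

lemma Generic.injective {ι : Type*} {w : ℝ} {U : ι → ℝ} (h : Generic w U) :
    Function.Injective U := by
  intro a b hab
  by_contra hne
  exact h.ne a b hne hab

lemma Generic.comp {ι κ : Type*} {w : ℝ} {U : ι → ℝ} (h : Generic w U) {e : κ → ι}
    (he : Function.Injective e) : Generic w (U ∘ e) where
  mem_Ioc _ := h.mem_Ioc _
  ne_one_sub _ := h.ne_one_sub _
  ne _ _ hab := h.ne _ _ (he.ne hab)
  ne_add _ _ hab := h.ne_add _ _ (he.ne hab)
  ne_add_add _ _ hab := h.ne_add_add _ _ (he.ne hab)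

/-- The relation "`W a` exceeds `W b` by less than `w`" on indices, except that its value at the
pair `(j, i)` is prescribed to be `p`. It describes configurations close to `W` when `W j = W i +
w`: the value at `(j, i)` then depends on the perturbation. -/
def pairRel {ι : Type*} (w : ℝ) (W : ι → ℝ) (i j : ι) (p : Prop) (a b : ι) : Prop :=
  (a = j ∧ b = i ∧ p) ∨ (¬(a = j ∧ b = i) ∧ W a < W b + w)

/-- Cliques according to whether they contain a distinguished index `j`, the other indices being
enumerated by `e`. -/
lemma hasClique_iff_of_compl {ι κ : Type*} {R : ι → ι → Prop} {k : ℕ} {e : κ → ι} {j : ι}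
    (he : Function.Injective e) (hj : ∀ x, e x ≠ j) (hs : ∀ a, a ≠ j → ∃ x, e x = a)
    (hR : R j j) :
    HasClique R k ↔ HasClique (fun x y => R (e x) (e y)) k ∨
      ∃ K : Finset κ, k ≤ K.card + 1 ∧ (∀ a ∈ K, ∀ b ∈ K, R (e a) (e b)) ∧
        ∀ a ∈ K, R (e a) j ∧ R j (e a) := by
  classical
  constructor
  · rintro ⟨I, hk, hI⟩
    have hsub : I ⊆ insert j ((I.preimage e he.injOn).map ⟨e, he⟩) := by
      intro a ha
      by_cases haj : a = j
      · simp [haj]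
      · obtain ⟨x, rfl⟩ := hs a haj
        simp [ha]
    by_cases hjI : j ∈ I
    · right
      refine ⟨I.preimage e he.injOn, ?_, ?_, ?_⟩
      · have h1 := Finset.card_le_card hsub
        have h2 := Finset.card_insert_le j ((I.preimage e he.injOn).map ⟨e, he⟩)
        rw [Finset.card_map] at h2
        omega
      · intro a ha b hb
        exact hI _ (Finset.mem_preimage.1 ha) _ (Finset.mem_preimage.1 hb)
      · intro a ha
        exact ⟨hI _ (Finset.mem_preimage.1 ha) _ hjI, hI _ hjI _ (Finset.mem_preimage.1 ha)⟩
    · left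
      refine ⟨I.preimage e he.injOn, ?_, ?_⟩
      · rw [Finset.subset_insert_iff_of_notMem hjI] at hsub
        have h1 := Finset.card_le_card hsub
        rw [Finset.card_map] at h1
        omega
      · intro a ha b hb
        exact hI _ (Finset.mem_preimage.1 ha) _ (Finset.mem_preimage.1 hb)
  · rintro (⟨K, hk, hK⟩ | ⟨K, hk, hK, hKj⟩)
    · refine ⟨K.map ⟨e, he⟩, by simpa using hk, ?_⟩
      simpa using hK
    · refine ⟨insert j (K.map ⟨e, he⟩), ?_, ?_⟩
      · rw [Finset.card_insert_of_notMem (by simpa using fun x _ => hj x), Finset.card_map]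
        exact hk
      · intro a ha b hb
        simp only [Finset.mem_insert, Finset.mem_map, Function.Embedding.coeFn_mk] at ha hb
        rcases ha with rfl | ⟨a, ha, rfl⟩ <;> rcases hb with rfl | ⟨b, hb, rfl⟩
        · exact hR
        · exact (hKj b hb).2
        · exact (hKj a ha).1
        · exact hK a ha b hb

lemma hasClique_pairRel_iff {ι κ : Type*} {w : ℝ} (hw : 0 < w) {k : ℕ} {e : κ → ι} {j : ι}
    (he : Function.Injective e) (hj : ∀ x, e x ≠ j) (hs : ∀ a, a ≠ j → ∃ x, e x = a)
    {V : κ → ℝ} {W : ι → ℝ} (i : κ) (hWe : ∀ x, W (e x) = V x) (hWj : W j = V i + w) (p : Prop) :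
    HasClique (pairRel w W (e i) j p) k ↔ HasClique (fun x y => V x < V y + w) k ∨
      ∃ K : Finset κ, k ≤ K.card + 1 ∧ (∀ a ∈ K, ∀ b ∈ K, V a < V b + w) ∧
        ∀ a ∈ K, V a < V i + w + w ∧ ((a = i ∧ p) ∨ (a ≠ i ∧ V i < V a)) := by
  have hjj : pairRel w W (e i) j p j j := by
    right; exact ⟨fun h => hj i h.2.symm, by linarith⟩
  rw [hasClique_iff_of_compl he hj hs hjj]
  have h1 : ∀ x y, pairRel w W (e i) j p (e x) (e y) ↔ V x < V y + w := by
    intro x y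
    simp [pairRel, hj x, hWe]
  have h2 : ∀ x, pairRel w W (e i) j p (e x) j ↔ V x < V i + w + w := by
    intro x
    simp [pairRel, hj x, hWe, hWj]
  have h3 : ∀ x, pairRel w W (e i) j p j (e x) ↔ ((x = i ∧ p) ∨ (x ≠ i ∧ V i < V x)) := by
    intro x
    simp [pairRel, he.eq_iff, hWe, hWj]
  simp only [h1, h2, h3]

/-- Put a further point at distance exactly `w` to the right of `V i`. Whether there is a cluster of
`k` points depends on the status of this single pair if and only if `V i` satisfies the conditions
in the definition of `nu`. -/
lemma critical_pair_iff {ι κ : Type*} [Fintype κ] {w : ℝ} (hw : 0 < w) (hw1 : w ≤ 1)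
    {k : ℕ} (hk : 2 ≤ k) {e : κ → ι} {j : ι}
    (he : Function.Injective e) (hj : ∀ x, e x ≠ j) (hs : ∀ a, a ≠ j → ∃ x, e x = a)
    {V : κ → ℝ} (hV : Generic w V)
    {W : ι → ℝ} (i : κ) (hWe : ∀ x, W (e x) = V x) (hWj : W j = V i + w) :
    (HasClique (pairRel w W (e i) j True) k ∧ ¬ HasClique (pairRel w W (e i) j False) k) ↔
      scanStat w (Finset.univ.val.map V) < k ∧
      numPoints (Finset.univ.val.map V) (Set.Ioc (V i) (V i + w)) = k - 2 ∧
      ∀ t : ℝ, V i ≤ t → t ≤ V i + w →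
        numPoints (Finset.univ.val.map V) (Set.Ioc t (t + w)) ≤ k - 2 := by
  classical
  rw [hasClique_pairRel_iff hw he hj hs i hWe hWj, hasClique_pairRel_iff hw he hj hs i hWe hWj,
    ← le_scanStat_map_iff hw1 hV.mem_Ioc]
  simp only [numPoints_map, Set.mem_Ioc]
  have key : ∀ K : Finset κ, (∀ a ∈ K, ∀ b ∈ K, V a < V b + w) →
      (∀ a ∈ K, V a < V i + w + w ∧ V i < V a) → ∃ t, V i ≤ t ∧ t ≤ V i + w ∧
        ∀ a ∈ K, t < V a ∧ V a ≤ t + w := by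
    intro K hK hKi
    rcases K.eq_empty_or_nonempty with rfl | hne
    · exact ⟨V i, le_rfl, by linarith, by simp⟩
    · obtain ⟨M, hM, hMax⟩ := K.exists_max_image V hne
      -- The window ends at the largest point, unless it would then start below `V i`.
      refine ⟨max (V i) (V M - w), le_max_left _ _, max_le (by linarith)
        (by linarith [(hKi M hM).1]), ?_⟩
      intro a ha
      refine ⟨max_lt (hKi a ha).2 (by linarith [hK M hM a ha]), ?_⟩
      linarith [hMax a ha, le_max_right (V i) (V M - w)]
  constructor
  · rintro ⟨h1 | ⟨K, hkK, hK, hKi⟩, h2⟩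
    · exact absurd (Or.inl h1) h2
    push Not at h2
    obtain ⟨h2, h3⟩ := h2
    -- A window with `k - 1` points would form a cluster with the additional point `V i + w`.
    have h4 : ∀ t : ℝ, V i ≤ t → t ≤ V i + w →
        (Finset.univ.filter fun a => t < V a ∧ V a ≤ t + w).card ≤ k - 2 := by
      intro t ht ht'
      by_contra hcon
      obtain ⟨a, ha, ha'⟩ := h3 (Finset.univ.filter fun a => t < V a ∧ V a ≤ t + w) (by omega)
        (by
          intro a ha b hb
          simp only [Finset.mem_filter] at ha hb
          linarith)
      simp only [Finset.mem_filter, Finset.mem_univ, true_and] at ha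
      have hai : a ≠ i := by
        rintro rfl
        linarith
      have hlt : V a < V i + w + w :=
        lt_of_le_of_ne (by linarith) (hV.ne_add_add a i hai)
      rcases ha' hlt with ⟨_, hc⟩
      linarith [hc hai]
    refine ⟨h2, le_antisymm (h4 _ le_rfl (by linarith)) ?_, h4⟩
    have : (K.erase i).card ≤ (Finset.univ.filter fun a => V i < V a ∧ V a ≤ V i + w).card := by
      refine Finset.card_le_card ?_
      intro a ha
      obtain ⟨hai, haK⟩ := Finset.mem_erase.1 ha
      simp only [Finset.mem_filter, Finset.mem_univ, true_and]
      have h5 := (hKi a haK).2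
      by_cases hiK : i ∈ K
      · have := hK a haK i hiK
        rcases h5 with h5 | h5
        · exact absurd h5.1 hai
        · exact ⟨h5.2, this.le⟩
      · exfalso
        obtain ⟨b, hb, hb'⟩ := h3 K hkK hK
        rcases (hKi b hb).2 with h6 | h6
        · exact hiK (h6.1 ▸ hb)
        · exact absurd h6.2 (not_lt.2 ((hb' (hKi b hb).1).2 h6.1))
    have h7 := Finset.pred_card_le_card_erase (s := K) (a := i)
    omega
  · rintro ⟨h1, h2, h3⟩
    refine ⟨Or.inr ⟨insert i (Finset.univ.filter fun a => V i < V a ∧ V a ≤ V i + w), ?_, ?_, ?_⟩,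
      ?_⟩
    · rw [Finset.card_insert_of_notMem (by simp)]
      omega
    · have hlt : ∀ a, V i < V a → V a ≤ V i + w → V a < V i + w := fun a h h' =>
        lt_of_le_of_ne h' (hV.ne_add a i (by rintro rfl; exact lt_irrefl _ h))
      intro a ha b hb
      simp only [Finset.mem_insert, Finset.mem_filter, Finset.mem_univ, true_and] at ha hb
      rcases ha with rfl | ha <;> rcases hb with rfl | hb
      · linarith
      · linarith
      · exact hlt a ha.1 ha.2
      · linarith
    · intro a ha
      simp only [Finset.mem_insert, Finset.mem_filter, Finset.mem_univ, true_and] at ha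
      rcases ha with rfl | ha
      · exact ⟨by linarith, by simp⟩
      · exact ⟨by linarith, Or.inr ⟨by rintro rfl; linarith, ha.1⟩⟩
    · rintro (h | ⟨K, hkK, hK, hKi⟩)
      · omega
      · obtain ⟨t, ht, ht', hKt⟩ := key K hK (fun a ha => ⟨(hKi a ha).1, by
          rcases (hKi a ha).2 with h | h
          · exact h.2.elim
          · exact h.2⟩)
        have h5 := h3 t ht ht'
        have h6 : K.card ≤ (Finset.univ.filter fun a => t < V a ∧ V a ≤ t + w).card := by
          refine Finset.card_le_card ?_
          intro a ha
          simpa using hKt a ha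
        omega

/-! ### Uniform samples and pairs of points in prescribed cells -/

/-- The uniform distribution on `(0, 1]`. -/
noncomputable def unif : Measure ℝ := volume.restrict (Set.Ioc 0 1)

instance : IsProbabilityMeasure unif := ⟨by simp [unif]⟩

instance : NullSingletonClass unif := by unfold unif; infer_instance

/-- The law of independent uniform points of `(0, 1]` indexed by `ι`. -/
noncomputable def unifPi (ι : Type*) [Fintype ι] : Measure (ι → ℝ) := Measure.pi fun _ => unif

instance (ι : Type*) [Fintype ι] : IsProbabilityMeasure (unifPi ι) := by
  unfold unifPi; infer_instance

lemma ae_unif_mem : ∀ᵐ x ∂unif, x ∈ Set.Ioc (0 : ℝ) 1 :=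
  ae_restrict_mem measurableSet_Ioc

/-- The index, counted from `0`, of the cell `(c / n, (c + 1) / n]` that contains `x ∈ (0, 1]`. -/
noncomputable def cell (n : ℕ) (x : ℝ) : ℕ := ⌈(n : ℝ) * x⌉₊ - 1

lemma measurable_cell (n : ℕ) : Measurable (cell n) :=
  (measurable_of_countable (fun m : ℕ => m - 1)).comp
    (Nat.measurable_ceil.comp (measurable_const_mul _))

lemma cell_eq_iff {n : ℕ} (hn : 0 < n) {x : ℝ} (hx : 0 < x) (c : ℕ) :
    cell n x = c ↔ (c : ℝ) < n * x ∧ (n : ℝ) * x ≤ c + 1 := by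
  have h : 0 < (n : ℝ) * x := by positivity
  have h1 : 0 < ⌈(n : ℝ) * x⌉₊ := Nat.ceil_pos.2 h
  have h2 := Nat.ceil_eq_iff (a := (n : ℝ) * x) (n := c + 1) (by omega)
  push_cast at h2
  rw [← h2]
  unfold cell
  omega

lemma lt_cell {n : ℕ} (hn : 0 < n) {x : ℝ} (hx : 0 < x) : (cell n x : ℝ) < n * x :=
  ((cell_eq_iff hn hx _).1 rfl).1

lemma le_cell {n : ℕ} (hn : 0 < n) {x : ℝ} (hx : 0 < x) : (n : ℝ) * x ≤ cell n x + 1 :=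
  ((cell_eq_iff hn hx _).1 rfl).2

lemma cell_lt {n : ℕ} (hn : 0 < n) {x : ℝ} (hx : x ∈ Set.Ioc (0 : ℝ) 1) : cell n x < n := by
  have h := lt_cell hn hx.1
  have : (cell n x : ℝ) < n := h.trans_le (mul_le_of_le_one_right (by positivity) hx.2)
  exact_mod_cast this

lemma cell_add_div {n : ℕ} (hn : 0 < n) (c : ℕ) {u : ℝ} (hu : u ∈ Set.Ioc (0 : ℝ) 1) :
    cell n ((c + u) / n) = c := by
  have hn' : (0 : ℝ) < n := by exact_mod_cast hn
  have := hu.1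
  rw [cell_eq_iff hn (by positivity), mul_div_cancel₀ _ hn'.ne']
  exact ⟨by linarith, by linarith [hu.2]⟩

lemma setLIntegral_cell {n : ℕ} (hn : 0 < n) (c : ℝ) (f : ℝ → ENNReal) :
    n * ∫⁻ y in Set.Ioc (c / n) ((c + 1) / n), f y = ∫⁻ v, f ((c + v) / n) ∂unif := by
  have hn' : (0 : ℝ) < n := by exact_mod_cast hn
  have himg : (fun v : ℝ => (c + v) / n) '' Set.Ioc 0 1 = Set.Ioc (c / n) ((c + 1) / n) := by
    ext y
    simp only [Set.mem_image, Set.mem_Ioc, div_lt_iff₀ hn', le_div_iff₀ hn']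
    constructor
    · rintro ⟨v, hv, rfl⟩
      rw [div_mul_cancel₀ _ hn'.ne']
      exact ⟨by linarith, by linarith⟩
    · rintro h
      exact ⟨y * n - c, ⟨by linarith, by linarith⟩, by field_simp; ring⟩
  have h := lintegral_image_eq_lintegral_abs_deriv_mul (s := Set.Ioc (0 : ℝ) 1)
    (f := fun v : ℝ => (c + v) / n) (f' := fun _ => 1 / n) measurableSet_Ioc
    (fun x _ => (((hasDerivAt_id x).const_add c).div_const _).hasDerivWithinAt)
    (fun x _ y _ hxy => by
      simp only at hxy
      field_simp at hxy
      linarith) f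
  rw [himg] at h
  rw [h, lintegral_const_mul' _ _ ENNReal.ofReal_ne_top, ← mul_assoc, abs_of_pos (by positivity),
    one_div, ENNReal.ofReal_inv_of_pos hn', ENNReal.ofReal_natCast,
    ENNReal.mul_inv_cancel (by exact_mod_cast hn.ne') (ENNReal.natCast_ne_top n), one_mul, unif]

lemma Ioc_inter_cell {n : ℕ} (hn : 0 < n) (c : ℕ) :
    {y | cell n y = c} ∩ Set.Ioc (0 : ℝ) 1 =
      if c < n then Set.Ioc ((c : ℝ) / n) ((c + 1) / n) else ∅ := by
  have hn' : (0 : ℝ) < n := by exact_mod_cast hn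
  split_ifs with hc
  · ext y
    simp only [Set.mem_inter_iff, Set.mem_ofPred_eq, Set.mem_Ioc, div_lt_iff₀ hn', le_div_iff₀ hn']
    have hc' : (c : ℝ) + 1 ≤ n := by exact_mod_cast hc
    constructor
    · rintro ⟨h, h0, h1⟩
      have := (cell_eq_iff hn h0 c).1 h
      rw [mul_comm] at this
      exact this
    · rintro ⟨h, h'⟩
      have h0 : 0 < y := by
        by_contra hcon
        have : y * n ≤ 0 := mul_nonpos_of_nonpos_of_nonneg (not_lt.1 hcon) hn'.le
        have : (0 : ℝ) ≤ c := by positivity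
        linarith
      refine ⟨(cell_eq_iff hn h0 c).2 (by rw [mul_comm]; exact ⟨h, h'⟩), h0, ?_⟩
      by_contra hcon
      have : 1 * (n : ℝ) < y * n := mul_lt_mul_of_pos_right (not_le.1 hcon) hn'
      linarith
  · ext y
    simp only [Set.mem_inter_iff, Set.mem_ofPred_eq, Set.mem_empty_iff_false, iff_false]
    rintro ⟨h, h'⟩
    have := cell_lt hn h'
    omega

lemma lintegral_cell {n : ℕ} (hn : 0 < n) (c : ℕ) {f : ℝ → ENNReal} :
    n * ∫⁻ y, {y | cell n y = c}.indicator f y ∂unif =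
      ∫⁻ v, (if c < n then f ((c + v) / n) else 0) ∂unif := by
  have hm : MeasurableSet {y | cell n y = c} := measurable_cell n (measurableSet_singleton c)
  rw [lintegral_indicator hm, unif, Measure.restrict_restrict hm, Ioc_inter_cell hn]
  split_ifs with hc
  · rw [setLIntegral_cell hn, unif]
  · simp

/-- Replacing the position of a uniform point within its cell by an independent uniform one does not
change its law. -/
lemma lintegral_unif_eq {n : ℕ} (hn : 0 < n) (f : ℝ → ENNReal) :
    ∫⁻ x, f x ∂unif = ∫⁻ x, ∫⁻ u, f ((cell n x + u) / n) ∂unif ∂unif := by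
  have hn0 : (n : ENNReal) ≠ 0 := by exact_mod_cast hn.ne'
  have hcover : Set.Ioc (0 : ℝ) 1 =
      ⋃ c ∈ Finset.range n, ({y | cell n y = c} ∩ Set.Ioc (0 : ℝ) 1) := by
    ext y
    simp only [Set.mem_iUnion, Finset.mem_range, Set.mem_inter_iff, Set.mem_ofPred_eq]
    constructor
    · intro h
      exact ⟨cell n y, cell_lt hn h, rfl, h⟩
    · rintro ⟨_, _, _, h⟩
      exact h
  have hsplit : ∀ g : ℝ → ENNReal, ∫⁻ x, g x ∂unif =
      ∑ c ∈ Finset.range n, ∫⁻ x in {y | cell n y = c} ∩ Set.Ioc (0 : ℝ) 1, g x := by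
    intro g
    conv_lhs => rw [unif, hcover]
    rw [lintegral_biUnion_finset]
    · intro a _ b _ hab
      refine Set.disjoint_left.2 ?_
      rintro x ⟨h1, _⟩ ⟨h2, _⟩
      exact hab (h1.symm.trans h2)
    · intro c _
      exact (measurable_cell n (measurableSet_singleton c)).inter measurableSet_Ioc
  rw [hsplit, hsplit]
  refine Finset.sum_congr rfl fun c hc => ?_
  have hm : MeasurableSet ({y | cell n y = c} ∩ Set.Ioc (0 : ℝ) 1) :=
    (measurable_cell n (measurableSet_singleton c)).inter measurableSet_Ioc
  have h1 : ∫⁻ x in {y | cell n y = c} ∩ Set.Ioc (0 : ℝ) 1, ∫⁻ u, f ((cell n x + u) / n) ∂unif =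
      ∫⁻ x in {y | cell n y = c} ∩ Set.Ioc (0 : ℝ) 1, ∫⁻ u, f ((c + u) / n) ∂unif := by
    refine setLIntegral_congr_fun hm ?_
    rintro x ⟨hx, _⟩
    simp only [Set.mem_ofPred_eq] at hx
    simp only [hx]
  rw [h1, Ioc_inter_cell hn, if_pos (Finset.mem_range.1 hc), ← setLIntegral_cell hn]
  have hvol : volume (Set.Ioc ((c : ℝ) / n) ((c + 1) / n)) = (n : ENNReal)⁻¹ := by
    rw [Real.volume_Ioc, ← sub_div, add_sub_cancel_left, one_div,
      ENNReal.ofReal_inv_of_pos (by exact_mod_cast hn), ENNReal.ofReal_natCast]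
  rw [setLIntegral_const, hvol, mul_comm, ← mul_assoc, ENNReal.inv_mul_cancel hn0
    (ENNReal.natCast_ne_top n), one_mul]

section Pair

variable {ι : Type*} [DecidableEq ι]

/-- The configuration `U` with point `i` moved to relative position `u` within its own cell, and
with point `j` placed at relative position `v` of the cell that is `L` cells further right. The old
value `U j` is discarded. -/
noncomputable def shift (n L : ℕ) (i j : ι) (U : ι → ℝ) (u v : ℝ) : ι → ℝ :=
  Function.update (Function.update U i ((cell n (U i) + u) / n)) j ((cell n (U i) + L + v) / n)

lemma measurable_update_prod {α : Type*} [MeasurableSpace α] {f : α → ι → ℝ} {g : α → ℝ} (i : ι)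
    (hf : Measurable f) (hg : Measurable g) :
    Measurable fun z => Function.update (f z) i (g z) := by
  refine measurable_pi_iff.2 fun a => ?_
  by_cases h : a = i
  · subst h; simpa using hg
  · simpa [Function.update_of_ne h] using (measurable_pi_iff.1 hf) a

lemma measurable_cell_apply {α : Type*} [MeasurableSpace α] (n : ℕ) {f : α → ℝ}
    (hf : Measurable f) : Measurable fun z => (cell n (f z) : ℝ) :=
  (measurable_of_countable (fun m : ℕ => (m : ℝ))).comp ((measurable_cell n).comp hf)

lemma measurable_shift (n L : ℕ) (i j : ι) {α : Type*} [MeasurableSpace α] {U : α → ι → ℝ}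
    {u v : α → ℝ} (hU : Measurable U) (hu : Measurable u) (hv : Measurable v) :
    Measurable fun z => shift n L i j (U z) (u z) (v z) := by
  have hc : Measurable fun z => (cell n (U z i) : ℝ) :=
    measurable_cell_apply n (measurable_pi_iff.1 hU i)
  unfold shift
  refine measurable_update_prod _ (measurable_update_prod _ hU ?_) ?_
  · exact (hc.add hu).div_const _
  · exact ((hc.add_const _).add hv).div_const _

lemma measurableSet_cell_add_lt (n L : ℕ) {α : Type*} [MeasurableSpace α] {f : α → ℝ}
    (hf : Measurable f) : MeasurableSet {z | cell n (f z) + L < n} :=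
  ((measurable_cell n).comp hf) (MeasurableSet.of_discrete (s := {m : ℕ | m + L < n}))

lemma measurableSet_shift (n L : ℕ) (i j : ι) {B : Set (ι → ℝ)} (hB : MeasurableSet B) :
    MeasurableSet {z : (ι → ℝ) × (ℝ × ℝ) |
      shift n L i j z.1 z.2.1 z.2.2 ∈ B ∧ cell n (z.1 i) + L < n} :=
  (measurable_shift n L i j (U := fun z : (ι → ℝ) × (ℝ × ℝ) => z.1) (u := fun z => z.2.1)
    (v := fun z => z.2.2) (by fun_prop) (by fun_prop) (by fun_prop) hB).inter
    (measurableSet_cell_add_lt n L (f := fun z : (ι → ℝ) × (ℝ × ℝ) => z.1 i) (by fun_prop))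

lemma measurable_ite_shift (n L : ℕ) (i j : ι) {b : (ι → ℝ) → ENNReal} (hb : Measurable b) :
    Measurable fun z : ((ι → ℝ) × ℝ) × ℝ => if cell n (z.1.1 i) + L < n then
      b (shift n L i j z.1.1 z.1.2 z.2) else 0 := by
  have h1 : Measurable fun z : ((ι → ℝ) × ℝ) × ℝ => shift n L i j z.1.1 z.1.2 z.2 :=
    measurable_shift n L i j (U := fun z : ((ι → ℝ) × ℝ) × ℝ => z.1.1) (u := fun z => z.1.2)
      (v := fun z => z.2) (by fun_prop) (by fun_prop) (by fun_prop)
  have h2 : MeasurableSet {z : ((ι → ℝ) × ℝ) × ℝ | cell n (z.1.1 i) + L < n} :=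
    measurableSet_cell_add_lt n L (f := fun z : ((ι → ℝ) × ℝ) × ℝ => z.1.1 i) (by fun_prop)
  exact Measurable.ite h2 (hb.comp h1) measurable_const

lemma measurable_ite_update (n L : ℕ) (i j : ι) {b : (ι → ℝ) → ENNReal} (hb : Measurable b) :
    Measurable fun z : (ι → ℝ) × ℝ => if cell n (z.1 i) + L < n then
      b (Function.update z.1 j ((cell n (z.1 i) + L + z.2) / n)) else 0 := by
  have hc : Measurable fun z : (ι → ℝ) × ℝ => ((cell n (z.1 i) : ℝ) + L + z.2) / n :=
    (((measurable_cell_apply n ((measurable_pi_apply i).comp measurable_fst)).add_const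
      _).add measurable_snd).div_const _
  have h1 : Measurable fun z : (ι → ℝ) × ℝ =>
      Function.update z.1 j (((cell n (z.1 i) : ℝ) + L + z.2) / n) :=
    measurable_update_prod j measurable_fst hc
  exact Measurable.ite
    (measurableSet_cell_add_lt n L (f := fun z : (ι → ℝ) × ℝ => z.1 i) (by fun_prop)) (hb.comp h1)
    measurable_const

variable [Fintype ι]

/-- The probability `1 / n` of having point `j` exactly `L` cells to the right of point `i` is
factored out: what remains is an integral over a full sample and two independent relative positions,
whose integrand converges pointwise as `n → ∞`. Resampling the position of point `i` within its cell
as well is what avoids the oscillating fractional part of `n U i`. -/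
lemma measure_inter_cell_pair {n : ℕ} (hn : 0 < n) (L : ℕ) {i j : ι} (hij : i ≠ j)
    {B : Set (ι → ℝ)} (hB : MeasurableSet B) :
    n * unifPi ι (B ∩ {U | cell n (U j) = cell n (U i) + L}) =
      ((unifPi ι).prod (unif.prod unif)) {z | shift n L i j z.1 z.2.1 z.2.2 ∈ B ∧
        cell n (z.1 i) + L < n} := by
  classical
  have hE : MeasurableSet {U : ι → ℝ | cell n (U j) = cell n (U i) + L} :=
    measurableSet_eq_fun ((measurable_cell n).comp (measurable_pi_apply j))
      ((measurable_of_countable (fun m : ℕ => m + L)).comp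
        ((measurable_cell n).comp (measurable_pi_apply i)))
  set b : (ι → ℝ) → ENNReal := B.indicator 1 with hb
  have hbm : Measurable b := measurable_one.indicator hB
  -- `F1` becomes `F2` on integrating out `U j`, and `F2` becomes `F3` on resampling `U i` within
  -- its cell.
  set F1 : (ι → ℝ) → ENNReal :=
    fun U => n * {U : ι → ℝ | cell n (U j) = cell n (U i) + L}.indicator b U with hF1
  set F2 : (ι → ℝ) → ENNReal := fun U => ∫⁻ v, (if cell n (U i) + L < n then
    b (Function.update U j ((cell n (U i) + L + v) / n)) else 0) ∂unif with hF2
  set F3 : (ι → ℝ) → ENNReal := fun U => ∫⁻ u, ∫⁻ v, (if cell n (U i) + L < n then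
    b (shift n L i j U u v) else 0) ∂unif ∂unif with hF3
  have hF1m : Measurable F1 := (hbm.indicator hE).const_mul _
  have hF2m : Measurable F2 := (measurable_ite_update n L i j hbm).lintegral_prod_right'
  have hF3m : Measurable F3 :=
    ((measurable_ite_shift n L i j hbm).lintegral_prod_right').lintegral_prod_right'
  have h12 : ∫⁻ U, F1 U ∂unifPi ι = ∫⁻ U, F2 U ∂unifPi ι := by
    rw [unifPi]
    refine lintegral_eq_of_lmarginal_eq {j} hF1m hF2m ?_
    rw [lmarginal_singleton, lmarginal_singleton]
    funext U
    have e1 : ∀ y, F1 (Function.update U j y) = n * ({y | cell n y = cell n (U i) + L}.indicator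
        (fun y => b (Function.update U j y)) y) := by
      intro y
      simp [hF1, Set.indicator_apply, Function.update_of_ne hij]
    have e2 : ∀ y, F2 (Function.update U j y) = F2 U := by
      intro y
      simp [hF2, Function.update_of_ne hij]
    simp only [e1, e2]
    rw [lintegral_const_mul' _ _ (ENNReal.natCast_ne_top n), lintegral_cell hn, lintegral_const,
      measure_univ, mul_one]
    simp [hF2]
  have h23 : ∫⁻ U, F2 U ∂unifPi ι = ∫⁻ U, F3 U ∂unifPi ι := by
    rw [unifPi]
    refine lintegral_eq_of_lmarginal_eq {i} hF2m hF3m ?_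
    rw [lmarginal_singleton, lmarginal_singleton]
    funext U
    rw [lintegral_unif_eq hn]
    refine lintegral_congr fun x => ?_
    refine lintegral_congr_ae ?_
    filter_upwards [ae_unif_mem] with u hu
    simp only [hF2, shift, Function.update_self, Function.update_idem, cell_add_div hn _ hu]
  have hlhs : n * unifPi ι (B ∩ {U | cell n (U j) = cell n (U i) + L}) =
      ∫⁻ U, F1 U ∂unifPi ι := by
    rw [hF1, lintegral_const_mul' _ _ (ENNReal.natCast_ne_top n), lintegral_indicator hE, hb,
      lintegral_indicator_one hB, Measure.restrict_apply hB]
  rw [hlhs, h12, h23, ← lintegral_indicator_one (measurableSet_shift n L i j hB)]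
  rw [lintegral_prod _ (by
    exact (measurable_one.indicator (measurableSet_shift n L i j hB)).aemeasurable)]
  refine lintegral_congr fun U => ?_
  rw [lintegral_prod _ (by
    exact ((measurable_one.indicator (measurableSet_shift n L i j hB)).comp
      measurable_prodMk_left).aemeasurable)]
  refine lintegral_congr fun u => lintegral_congr fun v => ?_
  simp only [hb, Set.indicator_apply, Set.mem_ofPred_eq, Pi.one_apply]
  split_ifs <;> simp_all

end Pair

/-! ### Asymptotics of the pair events -/

/-- First order inclusion-exclusion: pairwise intersections that are negligible at scale `1 / c` do
not contribute to the limit. -/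
lemma tendsto_measureReal_inter_biUnion {α κ : Type*} [MeasurableSpace α] {μ : Measure α}
    [IsFiniteMeasure μ] {c : ℕ → ℝ} (hc : ∀ m, 0 ≤ c m) {B : ℕ → Set α} {E : ℕ → κ → Set α}
    (hB : ∀ m, MeasurableSet (B m)) (hE : ∀ m x, MeasurableSet (E m x)) {l : κ → ℝ}
    (s : Finset κ) (h1 : ∀ x ∈ s, Tendsto (fun m => c m * μ.real (B m ∩ E m x)) atTop (𝓝 (l x)))
    (h2 : ∀ x ∈ s, ∀ y ∈ s, x ≠ y →
      Tendsto (fun m => c m * μ.real (E m x ∩ E m y)) atTop (𝓝 0)) :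
    Tendsto (fun m => c m * μ.real (B m ∩ ⋃ x ∈ s, E m x)) atTop (𝓝 (∑ x ∈ s, l x)) := by
  classical
  induction s using Finset.induction_on with
  | empty => simp
  | insert x s hx ih =>
    have ih' := ih (fun y hy => h1 y (Finset.mem_insert_of_mem hy))
      (fun y hy z hz => h2 y (Finset.mem_insert_of_mem hy) z (Finset.mem_insert_of_mem hz))
    have hx1 := h1 x (Finset.mem_insert_self x s)
    have hov : Tendsto (fun m => c m * μ.real ((B m ∩ E m x) ∩ (B m ∩ ⋃ y ∈ s, E m y))) atTop
        (𝓝 0) := by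
      have hsum : Tendsto (fun m => ∑ y ∈ s, c m * μ.real (E m x ∩ E m y)) atTop (𝓝 0) := by
        have := tendsto_finsetSum s (fun y hy => h2 x (Finset.mem_insert_self x s) y
          (Finset.mem_insert_of_mem hy) (by rintro rfl; exact hx hy))
        simpa using this
      refine squeeze_zero (fun m => mul_nonneg (hc m) measureReal_nonneg) (fun m => ?_) hsum
      rw [← Finset.mul_sum]
      refine mul_le_mul_of_nonneg_left ?_ (hc m)
      refine (measureReal_mono ?_ (measure_ne_top _ _)).trans
        (measureReal_biUnion_finset_le s fun y => E m x ∩ E m y)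
      rintro z ⟨⟨-, hz⟩, -, hz'⟩
      simp only [Set.mem_iUnion] at hz' ⊢
      obtain ⟨y, hy, hzy⟩ := hz'
      exact ⟨y, hy, hz, hzy⟩
    rw [Finset.sum_insert hx]
    have := (hx1.add ih').sub hov
    rw [sub_zero] at this
    refine this.congr fun m => ?_
    have hm : MeasurableSet (B m ∩ ⋃ y ∈ s, E m y) :=
      (hB m).inter (Finset.measurableSet_biUnion s fun y _ => hE m y)
    have h := measureReal_union_add_inter (μ := μ) (s := B m ∩ E m x) hm
    have heq : B m ∩ ⋃ y ∈ insert x s, E m y = (B m ∩ E m x) ∪ (B m ∩ ⋃ y ∈ s, E m y) := by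
      rw [Finset.set_biUnion_insert, Set.inter_union_distrib_left]
    rw [heq]
    linear_combination c m * h.symm

section Generic

variable {ι : Type*} [Fintype ι]

lemma ae_unifPi_eval {P : ℝ → Prop} (h : ∀ᵐ x ∂unif, P x) (i : ι) :
    ∀ᵐ U ∂unifPi ι, P (U i) :=
  Measure.tendsto_eval_ae_ae.eventually h

lemma ae_ne_add [DecidableEq ι] {a b : ι} (hab : a ≠ b) (c : ℝ) :
    ∀ᵐ U ∂unifPi ι, U a ≠ U b + c := by
  have hm : MeasurableSet {U : ι → ℝ | U a = U b + c} :=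
    measurableSet_eq_fun (by fun_prop) (by fun_prop)
  rw [ae_iff]
  simp only [not_not, unifPi]
  rw [← lintegral_indicator_one hm, ← lintegral_zero (μ := Measure.pi fun _ : ι => unif)]
  refine lintegral_eq_of_lmarginal_eq {a} (measurable_one.indicator hm) measurable_const ?_
  rw [lmarginal_singleton, lmarginal_singleton]
  funext U
  refine lintegral_congr_ae ?_
  have : ∀ᵐ y ∂unif, y ≠ U b + c := by simp [ae_iff]
  filter_upwards [this] with y hy
  simp [Function.update_of_ne hab.symm, hy]

lemma ae_generic [DecidableEq ι] (w : ℝ) : ∀ᵐ U ∂unifPi ι, Generic w U := by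
  have h1 : ∀ᵐ U ∂unifPi ι, ∀ i, U i ∈ Set.Ioc (0 : ℝ) 1 :=
    ae_all_iff.2 fun i => ae_unifPi_eval ae_unif_mem i
  have h2 : ∀ᵐ U ∂unifPi ι, ∀ i, U i ≠ 1 - w :=
    ae_all_iff.2 fun i => ae_unifPi_eval (P := fun x => x ≠ 1 - w) (by simp [ae_iff]) i
  have h3 : ∀ c, ∀ᵐ U ∂unifPi ι, ∀ a b, a ≠ b → U a ≠ U b + c := fun c =>
    ae_all_iff.2 fun a => ae_all_iff.2 fun b => by
      by_cases hab : a = b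
      · exact Eventually.of_forall fun U h => absurd hab h
      · filter_upwards [ae_ne_add hab c] with U hU _ using hU
  filter_upwards [h1, h2, h3 0, h3 w, h3 (w + w)] with U a1 a2 a3 a4 a5
  exact ⟨a1, a2, by simpa using a3, a4, by simpa [add_assoc] using a5⟩

end Generic

section Limits

lemma measurableSet_cellPair {ι : Type*} (n L : ℕ) (x : ι × ι) :
    MeasurableSet {U : ι → ℝ | cell n (U x.2) = cell n (U x.1) + L} :=
  measurableSet_eq_fun ((measurable_cell n).comp (measurable_pi_apply _))
    ((measurable_of_countable (fun m : ℕ => m + L)).comp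
      ((measurable_cell n).comp (measurable_pi_apply _)))

lemma eventually_lt_iff_of_tendsto {f g : ℕ → ℝ} {x y : ℝ} (hf : Tendsto f atTop (𝓝 x))
    (hg : Tendsto g atTop (𝓝 y)) (h : x ≠ y) : ∀ᶠ m in atTop, (f m < g m ↔ x < y) := by
  rcases lt_or_gt_of_ne h with h | h
  · filter_upwards [hf.eventually_lt hg h] with m hm
    exact iff_of_true hm h
  · filter_upwards [hg.eventually_lt hf h] with m hm
    exact iff_of_false hm.not_gt h.not_gt

lemma tendsto_cell_div {q : ℕ} (hq : 0 < q) {x : ℕ → ℝ} {y : ℝ} (hx : Tendsto x atTop (𝓝 y))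
    (hpos : ∀ᶠ m in atTop, 0 < x m) :
    Tendsto (fun m : ℕ => (cell (m * q) (x m) : ℝ) / (m * q : ℕ)) atTop (𝓝 y) := by
  have hn : Tendsto (fun m : ℕ => ((m * q : ℕ) : ℝ)) atTop atTop :=
    tendsto_natCast_atTop_atTop.comp (tendsto_id.atTop_mul_const' hq)
  have hinv : Tendsto (fun m : ℕ => 1 / ((m * q : ℕ) : ℝ)) atTop (𝓝 0) := hn.const_div_atTop 1
  have hlow : Tendsto (fun m : ℕ => x m - 1 / ((m * q : ℕ) : ℝ)) atTop (𝓝 y) := by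
    simpa using hx.sub hinv
  refine tendsto_of_tendsto_of_tendsto_of_le_of_le' hlow hx ?_ ?_
  · filter_upwards [hpos, eventually_gt_atTop 0] with m h0 hm
    have hN : 0 < m * q := Nat.mul_pos hm hq
    have hN' : (0 : ℝ) < (m * q : ℕ) := by exact_mod_cast hN
    have := le_cell hN h0
    rw [le_div_iff₀ hN', sub_mul, one_div, inv_mul_cancel₀ hN'.ne']
    linarith
  · filter_upwards [hpos, eventually_gt_atTop 0] with m h0 hm
    have hN : 0 < m * q := Nat.mul_pos hm hq
    have hN' : (0 : ℝ) < (m * q : ℕ) := by exact_mod_cast hN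
    have := lt_cell hN h0
    rw [div_le_iff₀ hN']
    linarith

lemma mul_div_mul_cast {q : ℕ} (p : ℕ) {m : ℕ} (hm : 0 < m) :
    ((m * p : ℕ) : ℝ) / ((m * q : ℕ) : ℝ) = (p : ℝ) / q := by
  have : (m : ℝ) ≠ 0 := by exact_mod_cast hm.ne'
  push_cast
  rw [mul_div_mul_left _ _ this]

lemma tendsto_const_div_natCast_mul {q : ℕ} (hq : 0 < q) (v : ℝ) :
    Tendsto (fun m : ℕ => v / ((m * q : ℕ) : ℝ)) atTop (𝓝 0) :=
  (tendsto_natCast_atTop_atTop.comp (tendsto_id.atTop_mul_const' hq)).const_div_atTop v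

variable {ι : Type*} [DecidableEq ι]

lemma tendsto_shift {q : ℕ} (hq : 0 < q) (p : ℕ) {U : ι → ℝ} {i j : ι} (hU : 0 < U i)
    (u v : ℝ) (a : ι) :
    Tendsto (fun m : ℕ => shift (m * q) (m * p) i j U u v a) atTop
      (𝓝 (Function.update U j (U i + p / q) a)) := by
  have hc := tendsto_cell_div hq (tendsto_const_nhds (x := U i))
    (Eventually.of_forall fun _ => hU)
  unfold shift
  by_cases haj : a = j
  · subst haj
    simp only [Function.update_self]
    have := (hc.add (tendsto_const_nhds (x := (p : ℝ) / q))).add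
      (tendsto_const_div_natCast_mul hq v)
    rw [add_zero] at this
    refine this.congr' ?_
    filter_upwards [eventually_gt_atTop 0] with m hm
    rw [← mul_div_mul_cast p hm, add_div, add_div]
  · simp only [Function.update_of_ne haj]
    by_cases hai : a = i
    · subst hai
      simp only [Function.update_self]
      have := hc.add (tendsto_const_div_natCast_mul hq u)
      rw [add_zero] at this
      refine this.congr fun m => ?_
      rw [add_div]
    · simp only [Function.update_of_ne hai]
      exact tendsto_const_nhds

lemma shift_pos {n : ℕ} (hn : 0 < n) (L : ℕ) {U : ι → ℝ} {i j : ι} (hU : ∀ a, 0 < U a) {u v : ℝ}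
    (hu : 0 < u) (hv : 0 < v) (a : ι) : 0 < shift n L i j U u v a := by
  have hn' : (0 : ℝ) < n := by exact_mod_cast hn
  unfold shift
  by_cases haj : a = j
  · subst haj
    simp only [Function.update_self]
    positivity
  · simp only [Function.update_of_ne haj]
    by_cases hai : a = i
    · subst hai
      simp only [Function.update_self]
      positivity
    · simpa only [Function.update_of_ne hai] using hU a

lemma tendsto_cell_shift {q : ℕ} (hq : 0 < q) (p : ℕ) {U : ι → ℝ} {i j : ι} (hU : ∀ a, 0 < U a)
    {u v : ℝ} (hu : 0 < u) (hv : 0 < v) (a : ι) :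
    Tendsto (fun m : ℕ => (cell (m * q) (shift (m * q) (m * p) i j U u v a) : ℝ) / (m * q : ℕ))
      atTop (𝓝 (Function.update U j (U i + p / q) a)) := by
  refine tendsto_cell_div hq (tendsto_shift hq p (hU i) u v a) ?_
  filter_upwards [eventually_gt_atTop 0] with m hm
  exact shift_pos (Nat.mul_pos hm hq) _ hU hu hv a

lemma eventually_shift_lt_iff {q : ℕ} (hq : 0 < q) (p : ℕ) {U : ι → ℝ} {i j : ι}
    (hU : ∀ a, 0 < U a) (u v w : ℝ) {W : ι → ℝ} (hW : W = Function.update U j (U i + p / q))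
    {a b : ι} (hab : W a ≠ W b + w) : ∀ᶠ m : ℕ in atTop,
      (shift (m * q) (m * p) i j U u v a < shift (m * q) (m * p) i j U u v b + w ↔
        W a < W b + w) := by
  subst hW
  exact eventually_lt_iff_of_tendsto (tendsto_shift hq p (hU i) u v a)
    ((tendsto_shift hq p (hU i) u v b).add_const w) hab

lemma eventually_cell_shift_lt_iff {q : ℕ} (hq : 0 < q) (p p' : ℕ) {U : ι → ℝ} {i j : ι}
    (hU : ∀ a, 0 < U a) {u v : ℝ} (hu : 0 < u) (hv : 0 < v) {W : ι → ℝ}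
    (hW : W = Function.update U j (U i + p / q)) {a b : ι} (hab : W a ≠ W b + (p' : ℝ) / q) :
    ∀ᶠ m : ℕ in atTop,
      (cell (m * q) (shift (m * q) (m * p) i j U u v a) <
        cell (m * q) (shift (m * q) (m * p) i j U u v b) + m * p' ↔ W a < W b + (p' : ℝ) / q) := by
  subst hW
  have h := eventually_lt_iff_of_tendsto (tendsto_cell_shift (j := j) hq p hU hu hv a)
    ((tendsto_cell_shift (j := j) hq p hU hu hv b).add_const ((p' : ℝ) / q)) hab
  filter_upwards [h, eventually_gt_atTop 0] with m h1 hm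
  have hN : (0 : ℝ) < (m * q : ℕ) := by exact_mod_cast Nat.mul_pos hm hq
  rw [← h1, ← mul_div_mul_cast p' hm, ← add_div, div_lt_div_iff_of_pos_right hN]
  exact_mod_cast Iff.rfl

lemma eventually_cell_shift_ne {q : ℕ} (hq : 0 < q) (p p' : ℕ) {U : ι → ℝ} {i j : ι}
    (hU : ∀ a, 0 < U a) {u v : ℝ} (hu : 0 < u) (hv : 0 < v) {W : ι → ℝ}
    (hW : W = Function.update U j (U i + p / q)) {a b : ι} (hab : W a ≠ W b + (p' : ℝ) / q) :
    ∀ᶠ m : ℕ in atTop, cell (m * q) (shift (m * q) (m * p) i j U u v a) ≠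
        cell (m * q) (shift (m * q) (m * p) i j U u v b) + m * p' := by
  subst hW
  have h := ((tendsto_cell_shift (j := j) hq p hU hu hv a).sub
    ((tendsto_cell_shift (j := j) hq p hU hu hv b).add_const ((p' : ℝ) / q))).eventually_ne
    (sub_ne_zero.2 hab)
  filter_upwards [h, eventually_gt_atTop 0] with m h1 hm
  rw [← mul_div_mul_cast p' hm, ← add_div, sub_ne_zero] at h1
  intro hc
  apply h1
  rw [hc]
  push_cast
  rfl

variable [Fintype ι]

/-- Dominated convergence in `measure_inter_cell_pair`. -/
lemma tendsto_measure_inter_cell_pair {q : ℕ} (hq : 0 < q) (p : ℕ) (w : ℝ) {i j : ι} (hij : i ≠ j)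
    {B : ℕ → Set (ι → ℝ)} (hB : ∀ m, MeasurableSet (B m)) {G : Set ((ι → ℝ) × (ℝ × ℝ))}
    (hG : MeasurableSet G)
    (hlim : ∀ U : ι → ℝ, Generic w U → ∀ u ∈ Set.Ioc (0 : ℝ) 1, ∀ v ∈ Set.Ioc (0 : ℝ) 1,
      ∀ᶠ m : ℕ in atTop, ((shift (m * q) (m * p) i j U u v ∈ B m ∧
        cell (m * q) (U i) + m * p < m * q) ↔ (U, (u, v)) ∈ G)) :
    Tendsto (fun m : ℕ => ((m * q : ℕ) : ℝ) * (unifPi ι).real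
        (B m ∩ {U | cell (m * q) (U j) = cell (m * q) (U i) + m * p})) atTop
      (𝓝 (((unifPi ι).prod (unif.prod unif)).real G)) := by
  have hae : ∀ᵐ z ∂((unifPi ι).prod (unif.prod unif)), ∀ᶠ m : ℕ in atTop,
      (z ∈ {z : (ι → ℝ) × (ℝ × ℝ) | shift (m * q) (m * p) i j z.1 z.2.1 z.2.2 ∈ B m ∧
        cell (m * q) (z.1 i) + m * p < m * q} ↔ z ∈ G) := by
    have h1 : ∀ᵐ z ∂((unifPi ι).prod (unif.prod unif)), Generic w z.1 :=
      Measure.quasiMeasurePreserving_fst.ae (ae_generic w)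
    have h2 : ∀ᵐ z ∂((unifPi ι).prod (unif.prod unif)), z.2.1 ∈ Set.Ioc (0 : ℝ) 1 :=
      Measure.quasiMeasurePreserving_snd.ae (Measure.quasiMeasurePreserving_fst.ae ae_unif_mem)
    have h3 : ∀ᵐ z ∂((unifPi ι).prod (unif.prod unif)), z.2.2 ∈ Set.Ioc (0 : ℝ) 1 :=
      Measure.quasiMeasurePreserving_snd.ae (Measure.quasiMeasurePreserving_snd.ae ae_unif_mem)
    filter_upwards [h1, h2, h3] with z a1 a2 a3
    exact hlim z.1 a1 z.2.1 a2 z.2.2 a3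
  have h := tendsto_measure_of_ae_tendsto_indicator_of_isFiniteMeasure atTop hG
    (fun m : ℕ => measurableSet_shift (m * q) (m * p) i j (hB m)) hae
  have h' := (ENNReal.tendsto_toReal (measure_ne_top _ G)).comp h
  refine Tendsto.congr' ?_ h'
  filter_upwards [eventually_gt_atTop 0] with m hm
  simp only [Function.comp]
  rw [← measure_inter_cell_pair (Nat.mul_pos hm hq) (m * p) hij (hB m), ENNReal.toReal_mul,
    ENNReal.toReal_natCast, measureReal_def]

/-- The union of several pair events, with `p = 0` (two points in the same cell) or `p / q = w` (two
points whose cells are a window length apart). For `p = 0` the events of `(i, j)` and `(j, i)`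
coincide, so only one of them may be listed in `s`. -/
lemma tendsto_measure_inter_cell_pairs {p q : ℕ} (hq : 0 < q) {w : ℝ} (hw : 0 < w)
    (hpw : p = 0 ∨ w = (p : ℝ) / q) {s : Finset (ι × ι)} (hs : ∀ x ∈ s, x.1 ≠ x.2)
    (hsw : p = 0 → ∀ x ∈ s, x.swap ∉ s)
    {B : ℕ → Set (ι → ℝ)} (hB : ∀ m, MeasurableSet (B m)) {G : ι × ι → Set ((ι → ℝ) × (ℝ × ℝ))}
    (hG : ∀ x, MeasurableSet (G x))
    (hlim : ∀ i j, (i, j) ∈ s → ∀ U : ι → ℝ, Generic w U → ∀ u ∈ Set.Ioc (0 : ℝ) 1,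
      ∀ v ∈ Set.Ioc (0 : ℝ) 1, ∀ᶠ m : ℕ in atTop, ((shift (m * q) (m * p) i j U u v ∈ B m ∧
        cell (m * q) (U i) + m * p < m * q) ↔ (U, (u, v)) ∈ G (i, j))) :
    Tendsto (fun m : ℕ => ((m * q : ℕ) : ℝ) * (unifPi ι).real
        (B m ∩ ⋃ x ∈ s, {U | cell (m * q) (U x.2) = cell (m * q) (U x.1) + m * p})) atTop
      (𝓝 (∑ x ∈ s, ((unifPi ι).prod (unif.prod unif)).real (G x))) := by
  refine tendsto_measureReal_inter_biUnion (fun m => Nat.cast_nonneg _) hB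
    (fun m x => measurableSet_cellPair _ _ x) s ?_ ?_
  · rintro ⟨i, j⟩ hx
    exact tendsto_measure_inter_cell_pair hq p w (hs _ hx) hB (hG _) (hlim i j hx)
  · rintro ⟨i, j⟩ hx ⟨a, b⟩ hy hxy
    have hij : i ≠ j := hs _ hx
    have hab : a ≠ b := hs _ hy
    have h := tendsto_measure_inter_cell_pair hq p w hij
      (B := fun m => {U | cell (m * q) (U b) = cell (m * q) (U a) + m * p})
      (fun m => measurableSet_cellPair _ _ (a, b)) (G := ∅) MeasurableSet.empty (by
        intro U hU u hu v hv
        have hne : Function.update U j (U i + p / q) b ≠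
            Function.update U j (U i + p / q) a + (p : ℝ) / q := by
          rcases hpw with rfl | hpw
          · have hsw' := hsw rfl _ hx
            simp only [Nat.cast_zero, zero_div, add_zero]
            by_cases hbj : b = j
            · subst hbj
              rw [Function.update_self, Function.update_of_ne hab]
              exact hU.ne _ _ (by rintro rfl; exact hxy rfl)
            · by_cases haj : a = j
              · subst haj
                rw [Function.update_self, Function.update_of_ne hbj]
                exact hU.ne _ _ (by rintro rfl; exact hsw' hy)
              · rw [Function.update_of_ne hbj, Function.update_of_ne haj]
                exact hU.ne _ _ hab.symm
          · rw [← hpw]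
            by_cases hbj : b = j
            · subst hbj
              rw [Function.update_self, Function.update_of_ne hab]
              have := hU.ne i a (by rintro rfl; exact hxy rfl)
              intro hc
              exact this (by linarith)
            · by_cases haj : a = j
              · subst haj
                rw [Function.update_self, Function.update_of_ne hbj]
                by_cases hbi : b = i
                · subst hbi
                  intro hc
                  linarith
                · exact hU.ne_add_add _ _ hbi
              · rw [Function.update_of_ne hbj, Function.update_of_ne haj]
                exact hU.ne_add _ _ hab.symm
        filter_upwards [eventually_cell_shift_ne hq p p (fun a => (hU.mem_Ioc a).1) hu.1 hv.1 rfl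
          hne] with m hm
        simp only [Set.mem_empty_iff_false, iff_false]
        rintro ⟨h, -⟩
        exact hm h)
    rw [measureReal_empty] at h
    refine h.congr fun m => ?_
    rw [Set.inter_comm]

end Limits

/-! ### The two contributions to the discretization error -/

section Contributions

lemma measurableSet_hasClique {α ι : Type*} [MeasurableSpace α] [Finite ι] {R : α → ι → ι → Prop}
    (hR : ∀ a b, MeasurableSet {z | R z a b}) (k : ℕ) : MeasurableSet {z | HasClique (R z) k} := by
  have : {z | HasClique (R z) k} =
      ⋃ I : Finset ι, ⋃ (_ : k ≤ I.card), ⋂ a ∈ I, ⋂ b ∈ I, {z | R z a b} := by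
    ext z
    simp [HasClique]
  rw [this]
  refine MeasurableSet.iUnion fun I => MeasurableSet.iUnion fun _ => ?_
  refine Finset.measurableSet_biInter _ fun a _ => Finset.measurableSet_biInter _ fun b _ => hR a b

lemma measurableSet_hasClique_lt {α ι : Type*} [MeasurableSpace α] [Finite ι] {W : α → ι → ℝ}
    (hW : Measurable W) (w : ℝ) (k : ℕ) :
    MeasurableSet {z | HasClique (fun a b => W z a < W z b + w) k} :=
  measurableSet_hasClique (fun a b => measurableSet_lt (measurable_pi_iff.1 hW a)
    ((measurable_pi_iff.1 hW b).add_const w)) k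

lemma measurableSet_hasClique_pairRel {α ι : Type*} [MeasurableSpace α] [Finite ι] {W : α → ι → ℝ}
    (hW : Measurable W) (w : ℝ) (i j : ι) (p : Prop) (k : ℕ) :
    MeasurableSet {z | HasClique (pairRel w (W z) i j p) k} := by
  refine measurableSet_hasClique (fun a b => ?_) k
  by_cases h : a = j ∧ b = i
  · simp [pairRel, h.1, h.2]
  · have := measurableSet_lt (measurable_pi_iff.1 hW a) ((measurable_pi_iff.1 hW b).add_const w)
    convert this using 2
    ext z
    unfold pairRel
    tauto

lemma eventually_hasClique_iff {ι : Type*} [Finite ι] {R : ℕ → ι → ι → Prop} {R' : ι → ι → Prop}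
    (h : ∀ a b, ∀ᶠ m in atTop, (R m a b ↔ R' a b)) (k : ℕ) :
    ∀ᶠ m in atTop, (HasClique (R m) k ↔ HasClique R' k) := by
  have : ∀ᶠ m in atTop, ∀ a b, (R m a b ↔ R' a b) :=
    eventually_all.2 fun a => eventually_all.2 fun b => h a b
  filter_upwards [this] with m hm using HasClique.congr hm

variable {ι : Type*} [DecidableEq ι]

lemma Generic.update_ne {w : ℝ} (hw : 0 < w) {U : ι → ℝ} (hU : Generic w U) (i j a b : ι) :
    Function.update U j (U i) a ≠ Function.update U j (U i) b + w := by
  have key : ∀ a b, U a ≠ U b + w := by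
    intro a b
    by_cases hab : a = b
    · subst hab; intro h; linarith
    · exact hU.ne_add a b hab
  have h : ∀ a, ∃ c, Function.update U j (U i) a = U c := by
    intro a
    by_cases ha : a = j
    · exact ⟨i, by rw [ha, Function.update_self]⟩
    · exact ⟨a, by rw [Function.update_of_ne ha]⟩
  obtain ⟨c, hc⟩ := h a
  obtain ⟨d, hd⟩ := h b
  rw [hc, hd]
  exact key c d

lemma Generic.update_add_ne {w : ℝ} (hw : 0 < w) {U : ι → ℝ} (hU : Generic w U) {i j a b : ι}
    (hab : ¬(a = j ∧ b = i)) :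
    Function.update U j (U i + w) a ≠ Function.update U j (U i + w) b + w := by
  by_cases ha : a = j
  · subst ha
    rw [Function.update_self]
    by_cases hb : b = a
    · subst hb
      rw [Function.update_self]
      intro h; linarith
    · rw [Function.update_of_ne hb]
      have := hU.ne i b (fun h => hab ⟨rfl, h.symm⟩)
      intro h
      exact this (by linarith)
  · rw [Function.update_of_ne ha]
    by_cases hb : b = j
    · subst hb
      rw [Function.update_self]
      by_cases hai : a = i
      · subst hai
        intro h; linarith
      · exact hU.ne_add_add _ _ hai
    · rw [Function.update_of_ne hb]
      by_cases h : a = b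
      · subst h
        intro h; linarith
      · exact hU.ne_add _ _ h

lemma Generic.update_add_ne_of_ne {w : ℝ} (hw : 0 < w) {U : ι → ℝ} (hU : Generic w U) {i j a b : ι}
    (hab : a ≠ b) : Function.update U j (U i + w) a ≠ Function.update U j (U i + w) b := by
  have key : ∀ c, c ≠ j → U i + w ≠ U c := by
    intro c hc
    by_cases hci : c = i
    · subst hci; intro h; linarith
    · exact (hU.ne_add c i hci).symm
  by_cases ha : a = j
  · subst ha
    rw [Function.update_self, Function.update_of_ne hab.symm]
    exact key b hab.symm
  · rw [Function.update_of_ne ha]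
    by_cases hb : b = j
    · subst hb
      rw [Function.update_self]
      exact (key a ha).symm
    · rw [Function.update_of_ne hb]
      exact hU.ne _ _ hab

variable [Fintype ι]

/-- Contribution of two points in the same cell: in the limit, point `x.1` is counted twice. -/
lemma tendsto_measure_collision {q : ℕ} (hq : 0 < q) {w : ℝ} (hw : 0 < w) (k : ℕ)
    {s : Finset (ι × ι)} (hs : ∀ x ∈ s, x.1 ≠ x.2) (hsw : ∀ x ∈ s, x.swap ∉ s) :
    Tendsto (fun m : ℕ => ((m * q : ℕ) : ℝ) * (unifPi ι).real
        ({U | HasClique (fun a b => U a < U b + w) k} ∩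
          ⋃ x ∈ s, {U | cell (m * q) (U x.2) = cell (m * q) (U x.1)})) atTop
      (𝓝 (∑ x ∈ s, (unifPi ι).real {U | HasClique (fun a b =>
        Function.update U x.2 (U x.1) a < Function.update U x.2 (U x.1) b + w) k})) := by
  set H : ι × ι → Set (ι → ℝ) := fun x => {U | HasClique (fun a b =>
        Function.update U x.2 (U x.1) a < Function.update U x.2 (U x.1) b + w) k} with hH
  have hHm : ∀ x, MeasurableSet (H x) := fun x =>
    measurableSet_hasClique_lt (measurable_update_prod _ measurable_id (measurable_pi_apply _)) w k
  have h := tendsto_measure_inter_cell_pairs (p := 0) hq hw (Or.inl rfl) hs (fun _ => hsw)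
    (B := fun _ => {U : ι → ℝ | HasClique (fun a b => U a < U b + w) k})
    (fun _ => measurableSet_hasClique_lt measurable_id w k)
    (G := fun x => H x ×ˢ Set.univ) (fun x => (hHm x).prod MeasurableSet.univ) (by
      intro i j hij U hU u hu v hv
      have h1 := eventually_hasClique_iff (fun a b => eventually_shift_lt_iff hq 0 (i := i) (j := j)
        (fun a => (hU.mem_Ioc a).1) u v w (W := Function.update U j (U i)) (by simp)
        (hU.update_ne hw i j a b)) k
      filter_upwards [h1, eventually_gt_atTop 0] with m hm hm0
      have h2 : cell (m * q) (U i) + m * 0 < m * q := by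
        simpa using cell_lt (Nat.mul_pos hm0 hq) (hU.mem_Ioc i)
      simp only [h2, and_true, Set.mem_prod, Set.mem_univ]
      exact hm)
  simp only [mul_zero, add_zero, measureReal_prod_prod, probReal_univ, mul_one] at h
  exact h

/-- By symmetry, the right ordering of two relative positions has probability `1 / 2`. -/
lemma unif_prod_lt : (unif.prod unif).real {z | z.2 < z.1} = 1 / 2 := by
  have hm : MeasurableSet {z : ℝ × ℝ | z.2 < z.1} := measurableSet_lt measurable_snd measurable_fst
  have hm' : MeasurableSet {z : ℝ × ℝ | z.1 < z.2} := measurableSet_lt measurable_fst measurable_snd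
  have hswap : (unif.prod unif).real {z | z.1 < z.2} = (unif.prod unif).real {z | z.2 < z.1} := by
    have := (Measure.measurePreserving_swap (μ := unif) (ν := unif)).measureReal_preimage
      hm.nullMeasurableSet
    rw [← this]
    rfl
  have hdiag : ∀ᵐ z ∂(unif.prod unif), z.1 ≠ z.2 := by
    refine (Measure.ae_prod_iff_ae_ae (p := fun z : ℝ × ℝ => z.1 ≠ z.2)
      (measurableSet_eq_fun measurable_fst measurable_snd).compl).2 ?_
    refine Eventually.of_forall fun x => ?_
    have : ∀ᵐ y ∂unif, y ≠ x := by simp [ae_iff]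
    filter_upwards [this] with y hy using hy.symm
  have hcompl : (unif.prod unif).real {z | z.2 < z.1}ᶜ = (unif.prod unif).real {z | z.1 < z.2} := by
    refine measureReal_congr ?_
    filter_upwards [hdiag] with z hz
    refine propext ?_
    show ¬ (z.2 < z.1) ↔ z.1 < z.2
    constructor
    · intro h
      exact lt_of_le_of_ne (not_lt.1 h) hz
    · intro h
      exact h.not_gt
  have := probReal_add_probReal_compl (μ := unif.prod unif) hm
  rw [hcompl, hswap] at this
  linarith

lemma measurableSet_cell_lt_cell_add {α : Type*} [MeasurableSpace α] (n L : ℕ) {f g : α → ℝ}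
    (hf : Measurable f) (hg : Measurable g) : MeasurableSet {z | cell n (f z) < cell n (g z) + L} :=
  measurableSet_lt ((measurable_cell n).comp hf)
    ((measurable_of_countable (fun m : ℕ => m + L)).comp ((measurable_cell n).comp hg))

lemma measurableSet_injective_cell {ι : Type*} [Finite ι] (n : ℕ) :
    MeasurableSet {U : ι → ℝ | Function.Injective fun a => cell n (U a)} := by
  have : {U : ι → ℝ | Function.Injective fun a => cell n (U a)} =
      (fun U : ι → ℝ => fun a => cell n (U a)) ⁻¹' {c | Function.Injective c} := rfl
  rw [this]
  have hm : Measurable fun U : ι → ℝ => fun a => cell n (U a) :=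
    measurable_pi_iff.2 fun a => (measurable_cell n).comp (measurable_pi_apply a)
  exact hm MeasurableSet.of_discrete

/-- The configurations in distinct cells that have a cluster of `k` points within distance `w` which
the windows of `L` cells do not detect. -/
def hiddenCluster (ι : Type*) (w : ℝ) (k n L : ℕ) : Set (ι → ℝ) :=
  {U | Function.Injective (fun a => cell n (U a)) ∧ HasClique (fun a b => U a < U b + w) k ∧
    ¬ HasClique (fun a b => cell n (U a) < cell n (U b) + L) k}

lemma measurableSet_hiddenCluster {ι : Type*} [Finite ι] (w : ℝ) (k n L : ℕ) :
    MeasurableSet (hiddenCluster ι w k n L) :=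
  (measurableSet_injective_cell n).inter ((measurableSet_hasClique_lt measurable_id w k).inter
    (measurableSet_hasClique (fun a b => measurableSet_cell_lt_cell_add n L
      (measurable_pi_apply a) (measurable_pi_apply b)) k).compl)

/-- The configurations in which a point placed at distance `w` to the right of point `i`, instead of
point `j`, lies below `1` and decides by its comparison with point `i` whether there is a cluster of
`k` points. The value `U j` is irrelevant. -/
def criticalPair (w : ℝ) (k : ℕ) (i j : ι) : Set (ι → ℝ) :=
  {U | U i + w < 1 ∧ HasClique (pairRel w (Function.update U j (U i + w)) i j True) k ∧
    ¬ HasClique (pairRel w (Function.update U j (U i + w)) i j False) k}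

lemma measurableSet_criticalPair (w : ℝ) (k : ℕ) (i j : ι) :
    MeasurableSet (criticalPair w k i j) := by
  have hW : Measurable fun U : ι → ℝ => Function.update U j (U i + w) :=
    measurable_update_prod (f := fun U : ι → ℝ => U) (g := fun U => U i + w) _ measurable_id
      (by fun_prop)
  exact (measurableSet_lt (f := fun U : ι → ℝ => U i + w) (g := fun _ => 1) (by fun_prop)
    measurable_const).inter
    ((measurableSet_hasClique_pairRel hW w i j True k).inter
      (measurableSet_hasClique_pairRel hW w i j False k).compl)

/-- Contribution of two points whose cells are a window length apart. Their actual distance is less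
than `w` exactly if the relative positions satisfy `v < u`; this is the source of the factor `1 /
2`, since in the limit it is independent of everything else. -/
lemma tendsto_measure_hidden {p q : ℕ} (hq : 0 < q) {w : ℝ} (hw : 0 < w)
    (hpw : w = (p : ℝ) / q) (k : ℕ) {s : Finset (ι × ι)} (hs : ∀ x ∈ s, x.1 ≠ x.2) :
    Tendsto (fun m : ℕ => ((m * q : ℕ) : ℝ) * (unifPi ι).real
        (hiddenCluster ι w k (m * q) (m * p) ∩
          ⋃ x ∈ s, {U | cell (m * q) (U x.2) = cell (m * q) (U x.1) + m * p})) atTop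
      (𝓝 (∑ x ∈ s, (unifPi ι).real (criticalPair w k x.1 x.2) * (1 / 2))) := by
  have hp : p ≠ 0 := by
    rintro rfl
    simp at hpw
    exact hw.ne' hpw
  have h := tendsto_measure_inter_cell_pairs hq hw (Or.inr hpw) hs (fun h => absurd h hp)
    (B := fun m => hiddenCluster ι w k (m * q) (m * p))
    (fun m => measurableSet_hiddenCluster w k _ _)
    (G := fun x => criticalPair w k x.1 x.2 ×ˢ {z | z.2 < z.1})
    (fun x => (measurableSet_criticalPair w k _ _).prod
      (measurableSet_lt (f := fun z : ℝ × ℝ => z.2) (g := fun z => z.1) measurable_snd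
        measurable_fst)) (by
      intro i j hx U hU u hu v hv
      have hij : i ≠ j := hs _ hx
      have hpos : ∀ a, 0 < U a := fun a => (hU.mem_Ioc a).1
      set W := Function.update U j (U i + w) with hW
      have hW' : W = Function.update U j (U i + p / q) := by rw [hW, hpw]
      have h1 := eventually_hasClique_iff (R := fun m a b =>
          shift (m * q) (m * p) i j U u v a < shift (m * q) (m * p) i j U u v b + w)
        (R' := pairRel w W i j (v < u)) (fun a b => by
          by_cases hab : a = j ∧ b = i
          · obtain ⟨rfl, rfl⟩ := hab
            filter_upwards [eventually_gt_atTop 0] with m hm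
            have hN : (0 : ℝ) < (m * q : ℕ) := by exact_mod_cast Nat.mul_pos hm hq
            have hb : shift (m * q) (m * p) b a U u v b =
                (cell (m * q) (U b) + u) / (m * q : ℕ) := by
              simp [shift, Function.update_of_ne hij]
            have ha : shift (m * q) (m * p) b a U u v a =
                (cell (m * q) (U b) + v) / (m * q : ℕ) + w := by
              rw [hpw, ← mul_div_mul_cast p hm, ← add_div]
              simp only [shift, Function.update_self]
              congr 1
              ring
            rw [ha, hb, add_lt_add_iff_right, div_lt_div_iff_of_pos_right hN, add_lt_add_iff_left]
            simp [pairRel]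
          · filter_upwards [eventually_shift_lt_iff hq p hpos u v w hW'
              (hU.update_add_ne hw hab)] with m hm
            rw [hm]
            unfold pairRel
            tauto) k
      have h2 := eventually_hasClique_iff (R := fun m a b =>
          cell (m * q) (shift (m * q) (m * p) i j U u v a) <
            cell (m * q) (shift (m * q) (m * p) i j U u v b) + m * p)
        (R' := pairRel w W i j False) (fun a b => by
          by_cases hab : a = j ∧ b = i
          · obtain ⟨rfl, rfl⟩ := hab
            filter_upwards [eventually_gt_atTop 0] with m hm
            have hN : 0 < m * q := Nat.mul_pos hm hq
            have hb : cell (m * q) (shift (m * q) (m * p) b a U u v b) = cell (m * q) (U b) := by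
              rw [← cell_add_div hN (cell (m * q) (U b)) hu]
              simp [shift, Function.update_of_ne hij]
            have ha : cell (m * q) (shift (m * q) (m * p) b a U u v a) =
                cell (m * q) (U b) + m * p := by
              rw [← cell_add_div hN (cell (m * q) (U b) + m * p) hv]
              simp [shift]
            rw [ha, hb]
            simp [pairRel]
          · filter_upwards [eventually_cell_shift_lt_iff hq p p hpos hu.1 hv.1 hW'
              (by rw [← hpw]; exact hU.update_add_ne hw hab)] with m hm
            rw [hm, ← hpw]
            unfold pairRel
            tauto) k
      have h3 : ∀ᶠ m : ℕ in atTop, ∀ a b, a ≠ b →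
          cell (m * q) (shift (m * q) (m * p) i j U u v a) ≠
            cell (m * q) (shift (m * q) (m * p) i j U u v b) := by
        refine eventually_all.2 fun a => eventually_all.2 fun b => ?_
        by_cases hab : a = b
        · exact Eventually.of_forall fun m h => absurd hab h
        · filter_upwards [eventually_cell_shift_ne hq p 0 hpos hu.1 hv.1 hW' (a := a) (b := b)
            (by simpa using hU.update_add_ne_of_ne hw hab)] with m hm _
          simpa using hm
      have h4 : ∀ᶠ m : ℕ in atTop, (cell (m * q) (U i) + m * p < m * q ↔ U i + w < 1) := by
        have ht := (tendsto_cell_div hq (tendsto_const_nhds (x := U i))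
          (Eventually.of_forall fun _ => hpos i)).add_const w
        have := eventually_lt_iff_of_tendsto ht (tendsto_const_nhds (x := (1 : ℝ)))
          (fun h => hU.ne_one_sub i (by linarith))
        filter_upwards [this, eventually_gt_atTop 0] with m h hm
        have hN : (0 : ℝ) < (m * q : ℕ) := by exact_mod_cast Nat.mul_pos hm hq
        rw [← h, hpw, ← mul_div_mul_cast p hm, ← add_div, div_lt_one hN]
        exact_mod_cast Iff.rfl
      filter_upwards [h1, h2, h3, h4] with m a1 a2 a3 a4
      have a3' : Function.Injective
          (fun a => cell (m * q) (shift (m * q) (m * p) i j U u v a)) := by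
        intro a b hab
        by_contra hne
        exact a3 a b hne hab
      have hl : shift (m * q) (m * p) i j U u v ∈ hiddenCluster ι w k (m * q) (m * p) ↔
          HasClique (pairRel w W i j (v < u)) k ∧ ¬ HasClique (pairRel w W i j False) k := by
        rw [← a1, ← a2]
        exact ⟨fun h => h.2, fun h => ⟨a3', h⟩⟩
      have hr : ((U, (u, v)) ∈ criticalPair w k i j ×ˢ {z : ℝ × ℝ | z.2 < z.1}) ↔
          (U i + w < 1 ∧ HasClique (pairRel w W i j True) k ∧
            ¬ HasClique (pairRel w W i j False) k) ∧ v < u := Iff.rfl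
      rw [hl, a4]
      refine Iff.trans ?_ hr.symm
      by_cases hvu : v < u
      · simp only [hvu]
        tauto
      · simp only [hvu]
        tauto)
  simp only [measureReal_prod_prod, unif_prod_lt] at h
  exact h

end Contributions

/-! ### The discrete scan statistic of the cells of a uniform sample -/

lemma unif_cell {n : ℕ} (hn : 0 < n) {c : ℕ} (hc : c < n) :
    unif {x | cell n x = c} = (n : ENNReal)⁻¹ := by
  have hm : MeasurableSet {y | cell n y = c} := measurable_cell n (measurableSet_singleton c)
  have h := lintegral_cell hn c (f := 1)
  rw [lintegral_indicator_one hm] at h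
  simp only [if_pos hc, Pi.one_apply, lintegral_one, measure_univ] at h
  exact ENNReal.eq_inv_of_mul_eq_one_left (by rw [mul_comm]; exact h)

lemma measure_cells_eq {n N : ℕ} (hn : 0 < n) {c : Fin N → ℕ} (hc : ∀ a, c a ∈ Finset.Icc 1 n) :
    unifPi (Fin N) {U | (fun a => cell n (U a) + 1) = c} = ((n : ENNReal)⁻¹) ^ N := by
  have h : {U : Fin N → ℝ | (fun a => cell n (U a) + 1) = c} =
      Set.pi Set.univ fun a => {x | cell n x = c a - 1} := by
    ext U
    simp only [Set.mem_ofPred_eq, Set.mem_pi, Set.mem_univ, true_implies, funext_iff]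
    refine forall_congr' fun a => ?_
    have := Finset.mem_Icc.1 (hc a)
    omega
  rw [h, unifPi, Measure.pi_pi]
  have : ∀ a, unif {x | cell n x = c a - 1} = (n : ENNReal)⁻¹ := fun a =>
    unif_cell hn (by have := Finset.mem_Icc.1 (hc a); omega)
  simp [this]

lemma card_injective_image_eq {n N : ℕ} {J : Finset ℕ} (hJ : J ∈ (Finset.Icc 1 n).powersetCard N)
    [DecidablePred fun c : Fin N → ℕ => Function.Injective c ∧ Finset.univ.image c = J] :
    ((Fintype.piFinset fun _ : Fin N => Finset.Icc 1 n).filter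
      fun c => Function.Injective c ∧ Finset.univ.image c = J).card = N.factorial := by
  obtain ⟨hJn, hJc⟩ := Finset.mem_powersetCard.1 hJ
  have : Fintype.card (Fin N ↪ J) = N.factorial := by
    rw [Fintype.card_embedding_eq, Fintype.card_fin, Fintype.card_coe, hJc, Nat.descFactorial_self]
  rw [← this, ← Finset.card_univ]
  symm
  refine Finset.card_bij (fun e _ a => (e a : ℕ)) ?_ ?_ ?_
  · intro e _
    have hinj : Function.Injective fun a => (e a : ℕ) :=
      Subtype.val_injective.comp e.injective
    refine Finset.mem_filter.2 ⟨Fintype.mem_piFinset.2 fun a => hJn (e a).2, hinj, ?_⟩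
    refine Finset.eq_of_subset_of_card_le ?_ ?_
    · intro x hx
      obtain ⟨a, -, rfl⟩ := Finset.mem_image.1 hx
      exact (e a).2
    · rw [Finset.card_image_of_injective _ hinj, Finset.card_univ, Fintype.card_fin, hJc]
  · intro e _ e' _ h
    ext a
    exact congrFun h a
  · intro c hc
    obtain ⟨-, hinj, himg⟩ := Finset.mem_filter.1 hc
    have hmem : ∀ a, c a ∈ J := fun a => himg ▸ Finset.mem_image_of_mem c (Finset.mem_univ a)
    exact ⟨⟨fun a => ⟨c a, hmem a⟩, fun a b hab => hinj (by simpa using hab)⟩,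
      Finset.mem_univ _, rfl⟩

lemma measure_injective_cells {n N : ℕ} (hn : 0 < n) (Q : Finset ℕ → Prop) [DecidablePred Q] :
    unifPi (Fin N) {U | Function.Injective (fun a => cell n (U a)) ∧
      Q (Finset.univ.image fun a => cell n (U a) + 1)} =
    (((Finset.Icc 1 n).powersetCard N).filter Q).card * (N.factorial * ((n : ENNReal)⁻¹) ^ N) := by
  classical
  set T := (Fintype.piFinset fun _ : Fin N => Finset.Icc 1 n).filter
    fun c => Function.Injective c ∧ Q (Finset.univ.image c) with hT
  have hcard : T.card = (((Finset.Icc 1 n).powersetCard N).filter Q).card * N.factorial := by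
    rw [Finset.card_eq_sum_card_fiberwise (f := fun c => Finset.univ.image c)
      (t := ((Finset.Icc 1 n).powersetCard N).filter Q), Finset.sum_const_nat]
    · intro J hJ
      obtain ⟨hJ, hQ⟩ := Finset.mem_filter.1 hJ
      rw [← card_injective_image_eq hJ]
      congr 1
      ext c
      simp only [hT, Finset.mem_filter]
      constructor
      · rintro ⟨⟨h1, h2, h3⟩, h4⟩
        exact ⟨h1, h2, h4⟩
      · rintro ⟨h1, h2, h4⟩
        exact ⟨⟨h1, h2, h4 ▸ hQ⟩, h4⟩
    · intro c hc
      obtain ⟨h1, h2, h3⟩ := Finset.mem_filter.1 hc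
      refine Finset.mem_filter.2 ⟨Finset.mem_powersetCard.2 ⟨?_, ?_⟩, h3⟩
      · intro x hx
        obtain ⟨a, -, rfl⟩ := Finset.mem_image.1 hx
        exact Fintype.mem_piFinset.1 h1 a
      · rw [Finset.card_image_of_injective _ h2, Finset.card_univ, Fintype.card_fin]
  have hC : Measurable fun U : Fin N → ℝ => fun a => cell n (U a) + 1 :=
    measurable_pi_iff.2 fun a => (measurable_of_countable (fun m : ℕ => m + 1)).comp
      ((measurable_cell n).comp (measurable_pi_apply a))
  have hae : {U : Fin N → ℝ | Function.Injective (fun a => cell n (U a)) ∧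
      Q (Finset.univ.image fun a => cell n (U a) + 1)} =ᵐ[unifPi (Fin N)]
      (fun U : Fin N → ℝ => fun a => cell n (U a) + 1) ⁻¹' (T : Set (Fin N → ℕ)) := by
    filter_upwards [ae_all_iff.2 fun i => ae_unifPi_eval ae_unif_mem i] with U hU
    refine propext ?_
    show (Function.Injective (fun a => cell n (U a)) ∧
      Q (Finset.univ.image fun a => cell n (U a) + 1)) ↔ (fun a => cell n (U a) + 1) ∈ T
    have h1 : (fun a => cell n (U a) + 1) ∈ Fintype.piFinset fun _ : Fin N => Finset.Icc 1 n := by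
      refine Fintype.mem_piFinset.2 fun a => Finset.mem_Icc.2 ?_
      have := cell_lt hn (hU a)
      omega
    have h2 : Function.Injective (fun a => cell n (U a) + 1) ↔
        Function.Injective (fun a => cell n (U a)) := by
      simp [Function.Injective]
    rw [hT, Finset.mem_filter, h2]
    tauto
  rw [measure_congr hae, ← sum_measure_preimage_singleton T
    (fun c _ => hC (measurableSet_singleton c))]
  rw [Finset.sum_congr rfl (g := fun _ => ((n : ENNReal)⁻¹) ^ N), Finset.sum_const, hcard,
    nsmul_eq_mul]
  · push_cast
    ring
  · intro c hc
    exact measure_cells_eq hn (Fintype.mem_piFinset.1 (Finset.mem_filter.1 hc).1)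

/-- Given that the cells of `N` uniform points are distinct, the set of these cells is a uniformly
chosen set of `N` cells: each set arises from `N!` of the `n ^ N` equally likely cell vectors. -/
lemma gammaDiscrete_mul {n L k N : ℕ} (hn : 0 < n) (hNn : N ≤ n) (hL : L ≤ n) (hk : 0 < k) :
    gammaDiscrete n L k N *
        (unifPi (Fin N)).real {U | Function.Injective fun a => cell n (U a)} =
      (unifPi (Fin N)).real {U | Function.Injective (fun a => cell n (U a)) ∧
        HasClique (fun a b => cell n (U a) < cell n (U b) + L) k} := by
  classical
  have h1 := measure_injective_cells (N := N) hn (fun _ => True)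
  have h2 := measure_injective_cells (N := N) hn (fun J => k ≤ discreteScanStat n L J)
  have h3 : {U : Fin N → ℝ | Function.Injective (fun a => cell n (U a)) ∧
        HasClique (fun a b => cell n (U a) < cell n (U b) + L) k} =ᵐ[unifPi (Fin N)]
      {U | Function.Injective (fun a => cell n (U a)) ∧
        k ≤ discreteScanStat n L (Finset.univ.image fun a => cell n (U a) + 1)} := by
    filter_upwards [ae_all_iff.2 fun i => ae_unifPi_eval ae_unif_mem i] with U hU
    refine propext (and_congr_right fun hinj => ?_)
    rw [le_discreteScanStat_iff hL hk]
    · exact HasClique.congr fun a b => by omega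
    · intro a b hab
      exact hinj (by simpa using hab)
    · intro a
      have := cell_lt hn (hU a)
      exact Finset.mem_Icc.2 (by omega)
  rw [measureReal_congr h3, measureReal_def, measureReal_def, h2]
  simp only [and_true, Finset.filter_true, Finset.card_powersetCard, Nat.card_Icc,
    add_tsub_cancel_right] at h1
  rw [h1, gammaDiscrete]
  simp only [ENNReal.toReal_mul, ENNReal.toReal_natCast]
  have : (n.choose N : ℝ) ≠ 0 := by exact_mod_cast (Nat.choose_pos hNn).ne'
  field_simp

/-! ### Random finite sets with the same joint laws of counts -/

/-- The points of `s` in increasing order if `s` has `N` points, and `0` otherwise. -/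
noncomputable def sortedTuple (N : ℕ) (s : Finset ℝ) : Fin N → ℝ :=
  if h : s.card = N then s.orderEmbOfFin h else 0

lemma image_sortedTuple {N : ℕ} {s : Finset ℝ} (h : s.card = N) :
    Finset.univ.image (sortedTuple N s) = s := by
  rw [sortedTuple, dif_pos h, Finset.image_orderEmbOfFin_univ]

lemma sortedTuple_injective {N : ℕ} {s : Finset ℝ} (h : s.card = N) :
    Function.Injective (sortedTuple N s) := by
  rw [sortedTuple, dif_pos h]
  exact (s.orderEmbOfFin h).injective

lemma numPoints_val (s : Finset ℝ) (B : Set ℝ) [DecidablePred (· ∈ B)] :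
    numPoints s.val B = (s.filter (· ∈ B)).card := by
  classical
  unfold numPoints
  rw [Multiset.countP_eq_card_filter, Finset.card_def, Finset.filter_val]
  congr

lemma sortedTuple_le_iff {N : ℕ} {s : Finset ℝ} (h : s.card = N) (i : Fin N) (t : ℝ) :
    sortedTuple N s i ≤ t ↔ (i : ℕ) + 1 ≤ numPoints s.val (Set.Iic t) := by
  classical
  rw [numPoints_val, sortedTuple, dif_pos h]
  set e := s.orderEmbOfFin h with he
  constructor
  · intro hi
    have : ((Finset.Iic i).map e.toEmbedding).card ≤ (s.filter (· ∈ Set.Iic t)).card := by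
      refine Finset.card_le_card ?_
      intro x hx
      obtain ⟨j, hj, rfl⟩ := Finset.mem_map.1 hx
      refine Finset.mem_filter.2 ⟨s.orderEmbOfFin_mem h j, ?_⟩
      exact (e.monotone (Finset.mem_Iic.1 hj)).trans hi
    simpa using this
  · intro hi
    by_contra hlt
    have : (s.filter (· ∈ Set.Iic t)).card ≤ ((Finset.Iio i).map e.toEmbedding).card := by
      refine Finset.card_le_card ?_
      intro x hx
      obtain ⟨hxs, hxt⟩ := Finset.mem_filter.1 hx
      have : x ∈ Set.range e := by rw [he, Finset.range_orderEmbOfFin]; exact hxs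
      obtain ⟨j, rfl⟩ := this
      refine Finset.mem_map.2 ⟨j, Finset.mem_Iio.2 ?_, rfl⟩
      exact e.lt_iff_lt.1 (lt_of_le_of_lt hxt (not_le.1 hlt))
    rw [Finset.card_map, Fin.card_Iio] at this
    omega

lemma numPoints_univ (s : Finset ℝ) : numPoints s.val Set.univ = s.card := by
  classical
  rw [numPoints_val]
  simp

section Law

variable {X : Type*} [MeasurableSpace X] {F : X → Finset ℝ}

lemma measurable_card
    (hF : ∀ B : Set ℝ, MeasurableSet B → Measurable fun x => numPoints (F x).val B) :
    Measurable fun x => (F x).card := by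
  simpa only [numPoints_univ] using hF Set.univ MeasurableSet.univ

lemma measurable_sortedTuple
    (hF : ∀ B : Set ℝ, MeasurableSet B → Measurable fun x => numPoints (F x).val B) (N : ℕ) :
    Measurable fun x => sortedTuple N (F x) := by
  refine measurable_pi_iff.2 fun i => measurable_of_Iic fun t => ?_
  have hc : MeasurableSet {x | (F x).card = N} :=
    measurable_card hF (measurableSet_singleton N)
  have h1 : MeasurableSet {x | (i : ℕ) + 1 ≤ numPoints (F x).val (Set.Iic t)} :=
    hF _ measurableSet_Iic (MeasurableSet.of_discrete (s := {m : ℕ | (i : ℕ) + 1 ≤ m}))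
  have : (fun x => sortedTuple N (F x) i) ⁻¹' Set.Iic t =
      ({x | (F x).card = N} ∩ {x | (i : ℕ) + 1 ≤ numPoints (F x).val (Set.Iic t)}) ∪
        ({x | (F x).card = N}ᶜ ∩ {_x | 0 ≤ t}) := by
    ext x
    by_cases h : (F x).card = N
    · simp [h, sortedTuple_le_iff h]
    · simp [h, sortedTuple]
  rw [this]
  exact (hc.inter h1).union (hc.compl.inter (MeasurableSet.const _))

lemma numPoints_preimage_eq_sum {r : ℕ} (s : Finset ℝ) (τ : ℝ → Fin r) (A : Set (Fin r))
    [DecidablePred (· ∈ A)] :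
    numPoints s.val (τ ⁻¹' A) = ∑ j with j ∈ A, numPoints s.val (τ ⁻¹' {j}) := by
  classical
  simp only [numPoints_val]
  rw [Finset.card_eq_sum_card_fiberwise (f := τ) (t := Finset.univ.filter (· ∈ A))]
  · refine Finset.sum_congr rfl fun j hj => ?_
    congr 1
    ext x
    simp only [Finset.mem_filter, Finset.mem_univ, true_and] at hj
    simp only [Finset.mem_filter, Set.mem_preimage, Set.mem_singleton_iff]
    constructor
    · rintro ⟨⟨h1, h2⟩, h3⟩
      exact ⟨h1, h3⟩
    · rintro ⟨h1, h3⟩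
      exact ⟨⟨h1, h3 ▸ hj⟩, h3⟩
  · intro x hx
    have := (Finset.mem_filter.1 hx).2
    exact Finset.mem_filter.2 ⟨Finset.mem_univ _, this⟩

/-- Two random sets of `N` points have the same order statistics if their joint laws of counts agree
for all finite measurable partitions of the line. -/
theorem map_sortedTuple_eq {Y : Type*} [MeasurableSpace Y] {G : Y → Finset ℝ} {μ : Measure X}
    {ν : Measure Y} [IsProbabilityMeasure μ] [IsProbabilityMeasure ν] {N : ℕ}
    (hF : ∀ B : Set ℝ, MeasurableSet B → Measurable fun x => numPoints (F x).val B)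
    (hG : ∀ B : Set ℝ, MeasurableSet B → Measurable fun y => numPoints (G y).val B)
    (hFN : ∀ᵐ x ∂μ, (F x).card = N) (hGN : ∀ᵐ y ∂ν, (G y).card = N)
    (hlaw : ∀ (r : ℕ) (τ : ℝ → Fin r), Measurable τ → ∀ a : Fin r → ℕ,
      μ {x | ∀ j, numPoints (F x).val (τ ⁻¹' {j}) = a j} =
        ν {y | ∀ j, numPoints (G y).val (τ ⁻¹' {j}) = a j}) :
    μ.map (fun x => sortedTuple N (F x)) = ν.map (fun y => sortedTuple N (G y)) := by
  classical
  have hFm := measurable_sortedTuple hF N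
  have hGm := measurable_sortedTuple hG N
  have : IsProbabilityMeasure (μ.map fun x => sortedTuple N (F x)) :=
    Measure.isProbabilityMeasure_map hFm.aemeasurable
  have : IsProbabilityMeasure (ν.map fun y => sortedTuple N (G y)) :=
    Measure.isProbabilityMeasure_map hGm.aemeasurable
  have hspan : IsCountablySpanning (Set.range (Set.Iic : ℝ → Set ℝ)) := by
    refine ⟨fun n => Set.Iic (n : ℝ), fun n => ⟨n, rfl⟩, ?_⟩
    refine Set.eq_univ_of_forall fun x => ?_
    obtain ⟨n, hn⟩ := exists_nat_ge x
    exact Set.mem_iUnion.2 ⟨n, hn⟩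
  have hgen : MeasurableSpace.generateFrom (Set.range (Set.Iic : ℝ → Set ℝ)) =
      Real.measurableSpace := by
    rw [← borel_eq_generateFrom_Iic]
    exact (BorelSpace.measurable_eq (α := ℝ)).symm
  refine ext_of_generate_finite _
    (generateFrom_eq_pi (fun _ : Fin N => hgen) fun _ => hspan).symm
    (IsPiSystem.pi fun _ => isPiSystem_Iic) ?_ (by simp)
  rintro _ ⟨S, hS, rfl⟩
  have hS' : ∀ i, ∃ t : ℝ, Set.Iic t = S i := fun i => hS i (Set.mem_univ i)
  choose t ht using hS'
  obtain rfl : (fun i => Set.Iic (t i)) = S := funext ht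
  have hbox : MeasurableSet (Set.pi Set.univ fun i => Set.Iic (t i)) :=
    MeasurableSet.univ_pi fun i => measurableSet_Iic
  rw [Measure.map_apply hFm hbox, Measure.map_apply hGm hbox]
  -- The atoms generated by the half-lines `Iic (t i)`, indexed by the set of `i` with `x ≤ t i`.
  let e := Fintype.equivFin (Finset (Fin N))
  let τ : ℝ → Fin (Fintype.card (Finset (Fin N))) :=
    fun x => e (Finset.univ.filter fun i => x ≤ t i)
  have hτ : Measurable τ := by
    refine (measurable_of_countable e).comp ?_
    refine measurable_to_countable' fun s => ?_
    have : (fun x : ℝ => Finset.univ.filter fun i => x ≤ t i) ⁻¹' {s} =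
        ⋂ i, {x | x ≤ t i ↔ i ∈ s} := by
      ext x
      simp [Finset.ext_iff]
    rw [this]
    refine MeasurableSet.iInter fun i => ?_
    by_cases hi : i ∈ s
    · simp only [hi, iff_true]; exact measurableSet_Iic
    · simp only [hi, iff_false]; exact measurableSet_Iic.compl
  have hIic : ∀ i, Set.Iic (t i) = τ ⁻¹' {j | i ∈ e.symm j} := by
    intro i
    ext x
    simp [τ]
  let D : Set (Fin (Fintype.card (Finset (Fin N))) → ℕ) :=
    {a | ∀ i : Fin N, (i : ℕ) + 1 ≤ ∑ j with j ∈ {j | i ∈ e.symm j}, a j}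
  have hset : ∀ s : Finset ℝ, s.card = N → ((∀ i, sortedTuple N s i ≤ t i) ↔
      (fun j => numPoints s.val (τ ⁻¹' {j})) ∈ D) := by
    intro s hs
    refine forall_congr' fun i => ?_
    rw [sortedTuple_le_iff hs, hIic, numPoints_preimage_eq_sum]
  have hcount : μ.map (fun x => fun j => numPoints (F x).val (τ ⁻¹' {j})) =
      ν.map (fun x => fun j => numPoints (G x).val (τ ⁻¹' {j})) := by
    refine Measure.ext_of_singleton fun a => ?_
    rw [Measure.map_apply (measurable_pi_iff.2 fun j => hF _ (hτ (measurableSet_singleton j)))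
        (measurableSet_singleton a),
      Measure.map_apply (measurable_pi_iff.2 fun j => hG _ (hτ (measurableSet_singleton j)))
        (measurableSet_singleton a)]
    simpa [Set.preimage, funext_iff] using hlaw _ τ hτ a
  have h1 : (fun x => sortedTuple N (F x)) ⁻¹' (Set.pi Set.univ fun i => Set.Iic (t i)) =ᵐ[μ]
      (fun x => fun j => numPoints (F x).val (τ ⁻¹' {j})) ⁻¹' D := by
    filter_upwards [hFN] with x hx
    refine propext ?_
    exact ⟨fun h => (hset _ hx).1 fun i => h i (Set.mem_univ i), fun h i _ => (hset _ hx).2 h i⟩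
  have h2 : (fun x => sortedTuple N (G x)) ⁻¹' (Set.pi Set.univ fun i => Set.Iic (t i)) =ᵐ[ν]
      (fun x => fun j => numPoints (G x).val (τ ⁻¹' {j})) ⁻¹' D := by
    filter_upwards [hGN] with x hx
    refine propext ?_
    exact ⟨fun h => (hset _ hx).1 fun i => h i (Set.mem_univ i), fun h i _ => (hset _ hx).2 h i⟩
  rw [measure_congr h1, measure_congr h2, ← Measure.map_apply (measurable_pi_iff.2 fun j =>
      hF _ (hτ (measurableSet_singleton j))) MeasurableSet.of_discrete, hcount,
    Measure.map_apply (measurable_pi_iff.2 fun j => hG _ (hτ (measurableSet_singleton j)))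
      MeasurableSet.of_discrete]

end Law

/-- The multinomial coefficient counts the maps with prescribed fiber sizes: compare coefficients in
the two expansions of `(∑ j, X j) ^ N`. -/
lemma card_fibers_eq_multinomial {N r : ℕ} (a : Fin r → ℕ) :
    (Finset.univ.filter fun f : Fin N → Fin r =>
      ∀ j, (Finset.univ.filter fun i => f i = j).card = a j).card =
      if ∑ j, a j = N then Nat.multinomial Finset.univ a else 0 := by
  classical
  have key : ∀ b : Fin r → ℕ, ∏ j, (MvPolynomial.X j : MvPolynomial (Fin r) ℕ) ^ b j =
      MvPolynomial.monomial (Finsupp.equivFunOnFinite.symm b) 1 := by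
    intro b
    rw [MvPolynomial.monomial_eq, map_one, one_mul, Finsupp.prod_fintype _ _ (by simp)]
    rfl
  have hfib : ∀ f : Fin N → Fin r, ∏ i, (MvPolynomial.X (f i) : MvPolynomial (Fin r) ℕ) =
      ∏ j, MvPolynomial.X j ^ (Finset.univ.filter fun i => f i = j).card := by
    intro f
    rw [← Finset.prod_fiberwise Finset.univ f]
    refine Finset.prod_congr rfl fun j _ => ?_
    rw [Finset.prod_congr rfl (g := fun _ => (MvPolynomial.X j : MvPolynomial (Fin r) ℕ)),
      Finset.prod_const]
    intro i hi
    rw [(Finset.mem_filter.1 hi).2]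
  have h1 := Fintype.sum_pow (fun j => (MvPolynomial.X j : MvPolynomial (Fin r) ℕ)) N
  have h2 := Finset.sum_pow_eq_sum_piAntidiag Finset.univ
    (fun j => (MvPolynomial.X j : MvPolynomial (Fin r) ℕ)) N
  rw [h1] at h2
  simp only [hfib, key] at h2
  have h3 := congrArg (MvPolynomial.coeff (Finsupp.equivFunOnFinite.symm a)) h2
  simp only [MvPolynomial.coeff_sum, MvPolynomial.coeff_monomial, ← nsmul_eq_mul,
    MvPolynomial.coeff_smul, EmbeddingLike.apply_eq_iff_eq, smul_eq_mul, mul_ite, mul_one,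
    mul_zero, Finset.sum_boole, Nat.cast_id, Finset.sum_ite_eq', Finset.mem_piAntidiag] at h3
  simpa [funext_iff] using h3

/-! ### Joint law of the counts: conditioned Poisson process and uniform sample -/

open Classical in
/-- The set of values of a sample of distinct points. Samples with repetitions, which form a null
set, are sent to `∅`; this makes the counts measurable in an obvious way. -/
noncomputable def samplePoints {N : ℕ} (U : Fin N → ℝ) : Finset ℝ :=
  if Function.Injective U then Finset.univ.image U else ∅

lemma numPoints_image {N : ℕ} {U : Fin N → ℝ} (hU : Function.Injective U) (B : Set ℝ)
    [DecidablePred (· ∈ B)] :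
    numPoints (Finset.univ.image U).val B = (Finset.univ.filter fun i => U i ∈ B).card := by
  rw [Finset.image_val_of_injOn hU.injOn, numPoints_map]

lemma measurableSet_injective {N : ℕ} :
    MeasurableSet {U : Fin N → ℝ | Function.Injective U} := by
  have : {U : Fin N → ℝ | Function.Injective U} =
      ⋂ a, ⋂ b, ⋂ (_ : a ≠ b), {U | U a = U b}ᶜ := by
    ext U
    simp only [Set.mem_ofPred_eq, Set.mem_iInter, Set.mem_compl_iff, Function.Injective]
    exact forall_congr' fun a => forall_congr' fun b => not_imp_not.symm
  rw [this]
  exact MeasurableSet.iInter fun a => MeasurableSet.iInter fun b => MeasurableSet.iInter fun _ =>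
    (measurableSet_eq_fun (measurable_pi_apply a) (measurable_pi_apply b)).compl

lemma measurable_numPoints_samplePoints {N : ℕ} (B : Set ℝ) (hB : MeasurableSet B) :
    Measurable fun U : Fin N → ℝ => numPoints (samplePoints U).val B := by
  classical
  have h : (fun U : Fin N → ℝ => numPoints (samplePoints U).val B) = fun U =>
      if Function.Injective U then ∑ i, (if U i ∈ B then 1 else 0) else 0 := by
    funext U
    unfold samplePoints
    split_ifs with hU
    · rw [numPoints_image hU, Finset.card_filter]
    · rw [numPoints_val]; simp
  rw [h]
  refine Measurable.ite measurableSet_injective ?_ measurable_const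
  refine Finset.measurable_fun_sum _ fun i _ => ?_
  exact Measurable.ite (measurable_pi_apply i hB) measurable_const measurable_const

lemma ae_injective (N : ℕ) : ∀ᵐ U ∂unifPi (Fin N), Function.Injective U := by
  filter_upwards [ae_generic 0] with U hU using hU.injective

lemma unifPi_counts (N r : ℕ) {τ : ℝ → Fin r} (hτ : Measurable τ) (a : Fin r → ℕ) :
    (unifPi (Fin N)).real {U | ∀ j, numPoints (samplePoints U).val (τ ⁻¹' {j}) = a j} =
      (if ∑ j, a j = N then Nat.multinomial Finset.univ a else 0 : ℕ) *
        ∏ j, unif.real (τ ⁻¹' {j}) ^ a j := by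
  classical
  set T := Finset.univ.filter fun f : Fin N → Fin r =>
      ∀ j, (Finset.univ.filter fun i => f i = j).card = a j with hT
  have hae : {U : Fin N → ℝ | ∀ j, numPoints (samplePoints U).val (τ ⁻¹' {j}) = a j}
      =ᵐ[unifPi (Fin N)] ⋃ f ∈ T, Set.pi Set.univ fun i => τ ⁻¹' {f i} := by
    filter_upwards [ae_injective N] with U hU
    have h : ∀ j, numPoints (samplePoints U).val (τ ⁻¹' {j}) =
        (Finset.univ.filter fun i => τ (U i) = j).card := by
      intro j
      rw [samplePoints, if_pos hU, numPoints_image hU]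
      simp
    have h1 : (∀ j, numPoints (samplePoints U).val (τ ⁻¹' {j}) = a j) ↔
        (fun i => τ (U i)) ∈ T := by
      simp only [h, hT, Finset.mem_filter, Finset.mem_univ, true_and]
    have h2 : (fun i => τ (U i)) ∈ T ↔ U ∈ ⋃ f ∈ T, Set.pi Set.univ fun i => τ ⁻¹' {f i} := by
      simp only [Set.mem_iUnion, Set.mem_pi, Set.mem_univ, true_implies, Set.mem_preimage,
        Set.mem_singleton_iff]
      constructor
      · intro h
        exact ⟨_, h, fun i => rfl⟩
      · rintro ⟨f, hf, hfi⟩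
        have : (fun i => τ (U i)) = f := funext hfi
        rwa [this]
    exact propext (h1.trans h2)
  have hbox : ∀ f : Fin N → Fin r,
      MeasurableSet (Set.pi Set.univ fun i => τ ⁻¹' {f i}) := fun f =>
    MeasurableSet.univ_pi fun i => hτ (measurableSet_singleton _)
  have hval : ∀ f ∈ T, (unifPi (Fin N)).real (Set.pi Set.univ fun i => τ ⁻¹' {f i}) =
      ∏ j, unif.real (τ ⁻¹' {j}) ^ a j := by
    intro f hf
    rw [measureReal_def, unifPi, Measure.pi_pi, ENNReal.toReal_prod,
      ← Finset.prod_fiberwise Finset.univ f]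
    refine Finset.prod_congr rfl fun j _ => ?_
    rw [← (Finset.mem_filter.1 hf).2 j, ← Finset.prod_const]
    refine Finset.prod_congr rfl fun i hi => ?_
    rw [(Finset.mem_filter.1 hi).2, measureReal_def]
  rw [measureReal_congr hae, measureReal_biUnion_finset _ (fun f _ => hbox f),
    Finset.sum_congr rfl hval, Finset.sum_const, nsmul_eq_mul, hT, card_fibers_eq_multinomial]
  intro f _ g _ hfg
  refine Set.disjoint_left.2 fun U hU hU' => hfg ?_
  funext i
  exact (hU i (Set.mem_univ i)).symm.trans (hU' i (Set.mem_univ i))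

section Poisson

variable {Ω : Type*} [MeasurableSpace Ω] {P : Measure Ω} {lam : ℝ≥0}
  {Pt : Ω → Finset ℝ}

lemma IsPoissonProcess.numPoints_inter (hPt : IsPoissonProcess P lam Pt) (ω : Ω) (B : Set ℝ) :
    numPoints (Pt ω).val (B ∩ Set.Ioc 0 1) = numPoints (Pt ω).val B := by
  classical
  rw [numPoints_val, numPoints_val]
  congr 1
  ext x
  simp only [Finset.mem_filter, Set.mem_inter_iff]
  constructor
  · rintro ⟨h1, h2, _⟩
    exact ⟨h1, h2⟩
  · rintro ⟨h1, h2⟩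
    exact ⟨h1, h2, hPt.subset_Ioc ω h1⟩

lemma IsPoissonProcess.measurable_card (hPt : IsPoissonProcess P lam Pt) :
    Measurable fun ω => (Pt ω).card :=
  ScanStatistic.measurable_card hPt.measurable_numPoints

lemma IsPoissonProcess.measureReal_numPoints (hPt : IsPoissonProcess P lam Pt) {B : Set ℝ}
    (hB : MeasurableSet B) (a : ℕ) :
    P.real {ω | numPoints (Pt ω).val B = a} =
      Real.exp (-(lam * unif.real B)) * (lam * unif.real B) ^ a / a.factorial := by
  have hB' : MeasurableSet (B ∩ Set.Ioc 0 1) := hB.inter measurableSet_Ioc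
  have h := hPt.map_numPoints _ hB' Set.inter_subset_right
  have h1 : P.real {ω | numPoints (Pt ω).val B = a} =
      (P.map fun ω => numPoints (Pt ω).val (B ∩ Set.Ioc 0 1)).real {a} := by
    rw [map_measureReal_apply (hPt.measurable_numPoints _ hB') (measurableSet_singleton a)]
    congr 1
    ext ω
    simp [hPt.numPoints_inter]
  have h2 : (volume (B ∩ Set.Ioc 0 1)).toReal = unif.real B := by
    rw [measureReal_def, unif, Measure.restrict_apply hB]
  rw [h1, h, poissonMeasure_real_singleton]
  push_cast
  rw [h2]

lemma IsPoissonProcess.measureReal_card (hPt : IsPoissonProcess P lam Pt) (N : ℕ) :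
    P.real {ω | (Pt ω).card = N} = Real.exp (-lam) * lam ^ N / N.factorial := by
  have h := hPt.measureReal_numPoints MeasurableSet.univ N
  simpa [numPoints_univ] using h

lemma IsPoissonProcess.measure_card_ne_zero (hPt : IsPoissonProcess P lam Pt) (hlam : 0 < lam)
    (N : ℕ) : P {ω | (Pt ω).card = N} ≠ 0 := by
  intro h0
  have := hPt.measureReal_card N
  rw [measureReal_def, h0, ENNReal.toReal_zero] at this
  have hlam' : (0 : ℝ) < lam := by exact_mod_cast hlam
  have h2 : 0 < Real.exp (-(lam : ℝ)) * lam ^ N / N.factorial := by positivity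
  linarith

lemma IsPoissonProcess.measureReal_counts (hPt : IsPoissonProcess P lam Pt) {r : ℕ}
    {τ : ℝ → Fin r} (hτ : Measurable τ) (a : Fin r → ℕ) :
    P.real {ω | ∀ j, numPoints (Pt ω).val (τ ⁻¹' {j}) = a j} =
      Real.exp (-lam) * lam ^ (∑ j, a j) * (∏ j, unif.real (τ ⁻¹' {j}) ^ a j) /
        ∏ j, ((a j).factorial : ℝ) := by
  have hm : ∀ j, MeasurableSet (τ ⁻¹' {j}) := fun j => hτ (measurableSet_singleton j)
  have hdisj : Pairwise fun i j => Disjoint (τ ⁻¹' {i}) (τ ⁻¹' {j}) := by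
    intro i j hij
    refine Set.disjoint_left.2 fun x hx hx' => hij (hx.symm.trans hx')
  have h := (hPt.iIndepFun_numPoints r _ hm hdisj).measure_inter_preimage_eq_mul Finset.univ
    (sets := fun j => {a j}) (fun j _ => measurableSet_singleton _)
  have hset : {ω | ∀ j, numPoints (Pt ω).val (τ ⁻¹' {j}) = a j} =
      ⋂ j ∈ Finset.univ, (fun ω => numPoints (Pt ω).val (τ ⁻¹' {j})) ⁻¹' {a j} := by
    ext ω
    simp
  have hsum : ∑ j, unif.real (τ ⁻¹' {j}) = 1 := by
    rw [sum_measureReal_preimage_singleton Finset.univ (fun j _ => hm j)]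
    simp
  rw [hset, measureReal_def, h, ENNReal.toReal_prod]
  have hj : ∀ j, (P ((fun ω => numPoints (Pt ω).val (τ ⁻¹' {j})) ⁻¹' {a j})).toReal =
      Real.exp (-(lam * unif.real (τ ⁻¹' {j}))) * (lam ^ a j * unif.real (τ ⁻¹' {j}) ^ a j) /
        (a j).factorial := by
    intro j
    rw [← mul_pow]
    exact hPt.measureReal_numPoints (hm j) (a j)
  simp only [hj]
  rw [Finset.prod_div_distrib, Finset.prod_mul_distrib, Finset.prod_mul_distrib,
    ← Real.exp_sum, Finset.sum_neg_distrib, ← Finset.mul_sum, hsum, mul_one,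
    Finset.prod_pow_eq_pow_sum]
  ring

/-- Conditionally on having `N` points, the counts of a Poisson process are multinomial, like those
of `N` independent uniform points. -/
lemma IsPoissonProcess.cond_counts [IsProbabilityMeasure P]
    (hPt : IsPoissonProcess P lam Pt) (hlam : 0 < lam) (N : ℕ)
    {r : ℕ} {τ : ℝ → Fin r} (hτ : Measurable τ) (a : Fin r → ℕ) :
    (ProbabilityTheory.cond P {ω | (Pt ω).card = N})
        {ω | ∀ j, numPoints (Pt ω).val (τ ⁻¹' {j}) = a j} =
      unifPi (Fin N) {U | ∀ j, numPoints (samplePoints U).val (τ ⁻¹' {j}) = a j} := by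
  have hcard : MeasurableSet {ω | (Pt ω).card = N} :=
    hPt.measurable_card (measurableSet_singleton N)
  have hsum : ∀ ω, (Pt ω).card = ∑ j, numPoints (Pt ω).val (τ ⁻¹' {j}) := by
    intro ω
    classical
    rw [← numPoints_univ, ← Set.preimage_univ (f := τ), numPoints_preimage_eq_sum]
    simp
  have hu := unifPi_counts N r hτ a
  rw [measureReal_def] at hu
  have hlam' : (0 : ℝ) < lam := by exact_mod_cast hlam
  rw [cond_apply hcard, ← ENNReal.toReal_eq_toReal_iff' ?_ (measure_ne_top _ _), hu,
    ENNReal.toReal_mul, ENNReal.toReal_inv, ← measureReal_def, ← measureReal_def,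
    hPt.measureReal_card]
  · split_ifs with ha
    · have hinter : {ω | (Pt ω).card = N} ∩
          {ω | ∀ j, numPoints (Pt ω).val (τ ⁻¹' {j}) = a j} =
          {ω | ∀ j, numPoints (Pt ω).val (τ ⁻¹' {j}) = a j} := by
        refine Set.inter_eq_right.2 fun ω hω => ?_
        show (Pt ω).card = N
        rw [hsum, ← ha]
        exact Finset.sum_congr rfl fun j _ => hω j
      have hspec := Nat.multinomial_spec Finset.univ a
      rw [ha] at hspec
      have hspec' : (∏ j, ((a j).factorial : ℝ)) * (Nat.multinomial Finset.univ a : ℝ) =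
          N.factorial := by exact_mod_cast hspec
      have hne : (∏ j, ((a j).factorial : ℝ)) ≠ 0 :=
        Finset.prod_ne_zero_iff.2 fun j _ => by exact_mod_cast (a j).factorial_ne_zero
      rw [hinter, hPt.measureReal_counts hτ, ha, ← hspec']
      have := Real.exp_pos (-(lam : ℝ))
      have h3 : (Nat.multinomial Finset.univ a : ℝ) ≠ 0 := by
        exact_mod_cast (Nat.multinomial_pos Finset.univ a).ne'
      field_simp
    · have hinter : {ω | (Pt ω).card = N} ∩
          {ω | ∀ j, numPoints (Pt ω).val (τ ⁻¹' {j}) = a j} = ∅ := by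
        refine Set.eq_empty_of_forall_notMem fun ω hω => ha ?_
        rw [← hω.1, hsum]
        exact Finset.sum_congr rfl fun j _ => (hω.2 j).symm
      rw [hinter]
      simp
  · rw [← cond_apply hcard]
    have := cond_isProbabilityMeasure (hPt.measure_card_ne_zero hlam N)
    exact measure_ne_top _ _

end Poisson

/-! ### Transfer from the Poisson process to the uniform sample -/

section Transfer

lemma measurableSet_generic {N : ℕ} (w : ℝ) : MeasurableSet {V : Fin N → ℝ | Generic w V} := by
  have h : {V : Fin N → ℝ | Generic w V} =
      (⋂ i, {V | V i ∈ Set.Ioc (0 : ℝ) 1}) ∩ ((⋂ i, {V | V i = 1 - w}ᶜ) ∩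
        ⋂ a, ⋂ b, ⋂ (_ : a ≠ b), ({V | V a = V b}ᶜ ∩ ({V | V a = V b + w}ᶜ ∩
          {V | V a = V b + w + w}ᶜ))) := by
    ext V
    simp only [Set.mem_ofPred_eq, Set.mem_inter_iff, Set.mem_iInter, Set.mem_compl_iff]
    constructor
    · rintro ⟨h1, h2, h3, h4, h5⟩
      exact ⟨h1, h2, fun a b hab => ⟨h3 a b hab, h4 a b hab, h5 a b hab⟩⟩
    · rintro ⟨h1, h2, h3⟩
      exact ⟨h1, h2, fun a b hab => (h3 a b hab).1, fun a b hab => (h3 a b hab).2.1,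
        fun a b hab => (h3 a b hab).2.2⟩
  rw [h]
  refine (MeasurableSet.iInter fun i => measurable_pi_apply i measurableSet_Ioc).inter
    ((MeasurableSet.iInter fun i =>
      (measurableSet_eq_fun (measurable_pi_apply i) measurable_const).compl).inter
    (MeasurableSet.iInter fun a => MeasurableSet.iInter fun b => MeasurableSet.iInter fun _ => ?_))
  exact (measurableSet_eq_fun (f := fun V : Fin N → ℝ => V a) (g := fun V => V b)
      (by fun_prop) (by fun_prop)).compl.inter
    ((measurableSet_eq_fun (f := fun V : Fin N → ℝ => V a) (g := fun V => V b + w)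
      (by fun_prop) (by fun_prop)).compl.inter
    (measurableSet_eq_fun (f := fun V : Fin N → ℝ => V a) (g := fun V => V b + w + w)
      (by fun_prop) (by fun_prop)).compl)

lemma card_samplePoints {N : ℕ} {U : Fin N → ℝ} (hU : Function.Injective U) :
    (samplePoints U).card = N := by
  rw [samplePoints, if_pos hU, Finset.card_image_of_injective _ hU, Finset.card_univ,
    Fintype.card_fin]

lemma Generic.sortedTuple_samplePoints {N : ℕ} {w : ℝ} {U : Fin N → ℝ} (hU : Generic w U) :
    Generic w (sortedTuple N (samplePoints U)) := by
  have hcard := card_samplePoints hU.injective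
  have h : ∀ i, ∃ j, U j = sortedTuple N (samplePoints U) i := by
    intro i
    have : sortedTuple N (samplePoints U) i ∈ samplePoints U := by
      have h := Finset.mem_image_of_mem (sortedTuple N (samplePoints U)) (Finset.mem_univ i)
      rwa [image_sortedTuple hcard] at h
    rw [samplePoints, if_pos hU.injective] at this
    obtain ⟨j, -, hj⟩ := Finset.mem_image.1 this
    refine ⟨j, ?_⟩
    rw [hj, samplePoints, if_pos hU.injective]
  choose σ hσ using h
  have hinj : Function.Injective σ := by
    intro a b hab
    refine sortedTuple_injective hcard ?_
    rw [← hσ a, ← hσ b, hab]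
  have : sortedTuple N (samplePoints U) = U ∘ σ := funext fun i => (hσ i).symm
  rw [this]
  exact hU.comp hinj

variable {Ω : Type*} [MeasurableSpace Ω] {P : Measure Ω} {lam : ℝ≥0} {Pt : Ω → Finset ℝ}

variable [IsProbabilityMeasure P]

lemma IsPoissonProcess.map_sortedTuple (hPt : IsPoissonProcess P lam Pt) (hlam : 0 < lam)
    (N : ℕ) :
    (ProbabilityTheory.cond P {ω | (Pt ω).card = N}).map (fun ω => sortedTuple N (Pt ω)) =
      (unifPi (Fin N)).map fun U => sortedTuple N (samplePoints U) := by
  have := cond_isProbabilityMeasure (hPt.measure_card_ne_zero hlam N)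
  refine map_sortedTuple_eq hPt.measurable_numPoints measurable_numPoints_samplePoints ?_ ?_
    (fun r τ hτ a => hPt.cond_counts hlam N hτ a)
  · exact ae_cond_mem (hPt.measurable_card (measurableSet_singleton N))
  · filter_upwards [ae_injective N] with U hU using card_samplePoints hU

lemma IsPoissonProcess.ae_generic_sortedTuple (hPt : IsPoissonProcess P lam Pt) (hlam : 0 < lam)
    (N : ℕ) (w : ℝ) : ∀ᵐ ω ∂(ProbabilityTheory.cond P {ω | (Pt ω).card = N}),
      Finset.univ.image (sortedTuple N (Pt ω)) = Pt ω ∧ Generic w (sortedTuple N (Pt ω)) := by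
  have h1 : ∀ᵐ ω ∂(ProbabilityTheory.cond P {ω | (Pt ω).card = N}), (Pt ω).card = N :=
    ae_cond_mem (hPt.measurable_card (measurableSet_singleton N))
  have h2 : ∀ᵐ ω ∂(ProbabilityTheory.cond P {ω | (Pt ω).card = N}),
      Generic w (sortedTuple N (Pt ω)) := by
    rw [← ae_map_iff (p := fun V => Generic w V)
      (measurable_sortedTuple hPt.measurable_numPoints N).aemeasurable (measurableSet_generic w),
      hPt.map_sortedTuple hlam,
      ae_map_iff (measurable_sortedTuple measurable_numPoints_samplePoints N).aemeasurable
        (measurableSet_generic w)]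
    filter_upwards [ae_generic w] with U hU using hU.sortedTuple_samplePoints
  filter_upwards [h1, h2] with ω a1 a2 using ⟨image_sortedTuple a1, a2⟩

lemma image_sortedTuple_samplePoints {N : ℕ} {U : Fin N → ℝ} (hU : Function.Injective U) :
    Finset.univ.image (sortedTuple N (samplePoints U)) = Finset.univ.image U := by
  rw [image_sortedTuple (card_samplePoints hU), samplePoints, if_pos hU]

/-- Conditionally on having `N` points, expectations of functionals of a Poisson process can be
computed for `N` independent uniform points. The functional need only be given by a measurable
function on generic samples. -/
theorem IsPoissonProcess.integral_cond (hPt : IsPoissonProcess P lam Pt) (hlam : 0 < lam) (w : ℝ)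
    {N : ℕ} {f : Finset ℝ → ℝ} {g : (Fin N → ℝ) → ℝ} (hg : Measurable g)
    (hfg : ∀ V, Generic w V → f (Finset.univ.image V) = g V) :
    AEStronglyMeasurable (fun ω => f (Pt ω)) (ProbabilityTheory.cond P {ω | (Pt ω).card = N}) ∧
      ∫ ω, f (Pt ω) ∂(ProbabilityTheory.cond P {ω | (Pt ω).card = N}) =
        ∫ U, g U ∂unifPi (Fin N) := by
  have hm := measurable_sortedTuple hPt.measurable_numPoints N
  have hms := measurable_sortedTuple (F := samplePoints (N := N))
    measurable_numPoints_samplePoints N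
  have hae : (fun ω => f (Pt ω)) =ᵐ[ProbabilityTheory.cond P {ω | (Pt ω).card = N}]
      fun ω => g (sortedTuple N (Pt ω)) := by
    filter_upwards [hPt.ae_generic_sortedTuple hlam N w] with ω hω
    rw [← hfg _ hω.2, hω.1]
  refine ⟨(hg.comp hm).aestronglyMeasurable.congr hae.symm, ?_⟩
  rw [integral_congr_ae hae, ← integral_map (f := g) hm.aemeasurable hg.aestronglyMeasurable,
    hPt.map_sortedTuple hlam, integral_map hms.aemeasurable hg.aestronglyMeasurable]
  refine integral_congr_ae ?_
  filter_upwards [ae_generic w] with U hU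
  rw [← hfg _ hU.sortedTuple_samplePoints, image_sortedTuple_samplePoints hU.injective, hfg _ hU]

lemma IsPoissonProcess.gamma_eq (hPt : IsPoissonProcess P lam Pt) (hlam : 0 < lam) {w : ℝ}
    (hw1 : w ≤ 1) (k N : ℕ) :
    gamma P Pt w k N = (unifPi (Fin N)).real {U | HasClique (fun a b => U a < U b + w) k} := by
  classical
  have hA : MeasurableSet {U : Fin N → ℝ | HasClique (fun a b => U a < U b + w) k} :=
    measurableSet_hasClique_lt measurable_id w k
  have hV : ∀ V : Fin N → ℝ, Generic w V → (k ≤ scanStat w (Finset.univ.image V).val ↔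
      V ∈ {U : Fin N → ℝ | HasClique (fun a b => U a < U b + w) k}) := by
    intro V hV
    rw [Finset.image_val_of_injOn hV.injective.injOn]
    exact le_scanStat_map_iff hw1 hV.mem_Ioc k
  have hm := measurable_sortedTuple hPt.measurable_numPoints N
  have hms := measurable_sortedTuple (F := samplePoints (N := N))
    measurable_numPoints_samplePoints N
  have h1 : {ω | k ≤ scanStat w (Pt ω).val} =ᵐ[ProbabilityTheory.cond P {ω | (Pt ω).card = N}]
      (fun ω => sortedTuple N (Pt ω)) ⁻¹'
        {U : Fin N → ℝ | HasClique (fun a b => U a < U b + w) k} := by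
    filter_upwards [hPt.ae_generic_sortedTuple hlam N w] with ω hω
    have := hV _ hω.2
    rw [hω.1] at this
    exact propext this
  have h2 : (fun U => sortedTuple N (samplePoints U)) ⁻¹'
        {U : Fin N → ℝ | HasClique (fun a b => U a < U b + w) k} =ᵐ[unifPi (Fin N)]
      {U : Fin N → ℝ | HasClique (fun a b => U a < U b + w) k} := by
    filter_upwards [ae_generic w] with U hU
    have := hV _ hU.sortedTuple_samplePoints
    rw [image_sortedTuple_samplePoints hU.injective] at this
    exact propext (this.symm.trans (hV U hU))
  rw [gamma, measureReal_congr h1, ← map_measureReal_apply hm hA, hPt.map_sortedTuple hlam,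
    map_measureReal_apply hms hA, measureReal_congr h2]

end Transfer

/-! ### The functionals of the limit as sums over the sample -/

lemma univ_val_map_succAbove {n : ℕ} (j : Fin (n + 1)) (U : Fin (n + 1) → ℝ) :
    Finset.univ.val.map U = U j ::ₘ Finset.univ.val.map (U ∘ j.succAbove) := by
  rw [Fin.univ_succAbove n j, Finset.cons_val, Multiset.map_cons, Finset.map_val,
    Multiset.map_map]
  rfl

/-- The condition on the point `V i` in the definition of `nu`. -/
def IsCritical {n : ℕ} (w : ℝ) (k : ℕ) (V : Fin n → ℝ) (i : Fin n) : Prop :=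
  V i < 1 - w ∧ scanStat w (Finset.univ.val.map V) < k ∧
    numPoints (Finset.univ.val.map V) (Set.Ioc (V i) (V i + w)) = k - 2 ∧
      ∀ t : ℝ, V i ≤ t → t ≤ V i + w →
        numPoints (Finset.univ.val.map V) (Set.Ioc t (t + w)) ≤ k - 2

lemma mem_criticalPair_iff {n : ℕ} {w : ℝ} (hw : 0 < w) (hw1 : w ≤ 1) {k : ℕ} (hk : 2 ≤ k)
    (j : Fin (n + 1)) (i : Fin n) {U : Fin (n + 1) → ℝ} (hU : Generic w (U ∘ j.succAbove)) :
    U ∈ criticalPair w k (j.succAbove i) j ↔ IsCritical w k (U ∘ j.succAbove) i := by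
  have h := critical_pair_iff hw hw1 hk (Fin.succAbove_right_injective (p := j))
    (fun x => Fin.succAbove_ne j x) (fun _ ha => Fin.exists_succAbove_eq ha) hU
    (W := Function.update U j (U (j.succAbove i) + w)) i
    (fun x => Function.update_of_ne (Fin.succAbove_ne j x) _ _) (Function.update_self _ _ _)
  have h0 : U (j.succAbove i) + w < 1 ↔ (U ∘ j.succAbove) i < 1 - w := by
    rw [lt_sub_iff_add_lt]; rfl
  exact and_congr h0 h

lemma mem_doubled_iff {n : ℕ} {w : ℝ} (hw1 : w ≤ 1) (k : ℕ)
    (j : Fin (n + 1)) (i : Fin n) {U : Fin (n + 1) → ℝ} (hU : Generic w (U ∘ j.succAbove)) :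
    HasClique (fun a b => Function.update U j (U (j.succAbove i)) a <
      Function.update U j (U (j.succAbove i)) b + w) k ↔
      k ≤ scanStat w ((U ∘ j.succAbove) i ::ₘ Finset.univ.val.map (U ∘ j.succAbove)) := by
  rw [← le_scanStat_map_iff hw1, univ_val_map_succAbove j, Function.update_self]
  · have : Function.update U j (U (j.succAbove i)) ∘ j.succAbove = U ∘ j.succAbove := by
      funext x
      exact Function.update_of_ne (Fin.succAbove_ne j x) _ _
    rw [this]
    rfl
  · intro a
    by_cases ha : a = j
    · rw [ha, Function.update_self]
      exact hU.mem_Ioc i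
    · obtain ⟨x, rfl⟩ := Fin.exists_succAbove_eq ha
      rw [Function.update_of_ne ha]
      exact hU.mem_Ioc x

/-- A measurable version of `IsCritical`. The leading entry `0` is a placeholder that `criticalPair`
discards. -/
def criticalSet {n : ℕ} (w : ℝ) (k : ℕ) (i : Fin n) : Set (Fin n → ℝ) :=
  {V | (Fin.cons 0 V : Fin (n + 1) → ℝ) ∈ criticalPair w k i.succ 0}

/-- The samples whose scan statistic is at least `k` once point `i` is counted twice. -/
def doubledSet {n : ℕ} (w : ℝ) (k : ℕ) (i : Fin n) : Set (Fin n → ℝ) :=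
  {V | HasClique (fun a b => (Fin.cons (V i) V : Fin (n + 1) → ℝ) a <
    (Fin.cons (V i) V : Fin (n + 1) → ℝ) b + w) k}

lemma measurable_cons {α : Type*} [MeasurableSpace α] {n : ℕ} {f : α → ℝ} {g : α → Fin n → ℝ}
    (hf : Measurable f) (hg : Measurable g) :
    Measurable fun z => (Fin.cons (f z) (g z) : Fin (n + 1) → ℝ) := by
  refine measurable_pi_iff.2 fun a => ?_
  refine Fin.cases ?_ (fun i => ?_) a
  · simpa using hf
  · simpa using measurable_pi_iff.1 hg i

lemma measurableSet_criticalSet {n : ℕ} (w : ℝ) (k : ℕ) (i : Fin n) :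
    MeasurableSet (criticalSet w k i) :=
  (measurable_cons (f := fun _ : Fin n → ℝ => 0) (g := fun V => V) measurable_const
    measurable_id) (measurableSet_criticalPair w k i.succ 0)

lemma measurableSet_doubledSet {n : ℕ} (w : ℝ) (k : ℕ) (i : Fin n) :
    MeasurableSet (doubledSet w k i) :=
  measurableSet_hasClique_lt (measurable_cons (f := fun V : Fin n → ℝ => V i) (g := fun V => V)
    (measurable_pi_apply i) measurable_id) w k

lemma cons_comp_succAbove {n : ℕ} (x : ℝ) (V : Fin n → ℝ) :
    (Fin.cons x V : Fin (n + 1) → ℝ) ∘ (0 : Fin (n + 1)).succAbove = V := by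
  funext i
  simp

lemma mem_criticalSet_iff {n : ℕ} {w : ℝ} (hw : 0 < w) (hw1 : w ≤ 1) {k : ℕ} (hk : 2 ≤ k)
    (i : Fin n) {V : Fin n → ℝ} (hV : Generic w V) :
    V ∈ criticalSet w k i ↔ IsCritical w k V i := by
  have h := mem_criticalPair_iff hw hw1 hk 0 i (U := Fin.cons 0 V)
    (by rwa [cons_comp_succAbove])
  rw [cons_comp_succAbove, Fin.zero_succAbove] at h
  exact h

lemma mem_doubledSet_iff {n : ℕ} {w : ℝ} (hw1 : w ≤ 1) (k : ℕ) (i : Fin n) {V : Fin n → ℝ}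
    (hV : Generic w V) :
    V ∈ doubledSet w k i ↔ k ≤ scanStat w (V i ::ₘ Finset.univ.val.map V) := by
  have h := mem_doubled_iff hw1 k 0 i (U := Fin.cons (V i) V)
    (by rwa [cons_comp_succAbove])
  rw [cons_comp_succAbove, Fin.zero_succAbove, Fin.cons_succ] at h
  have h0 : Function.update (Fin.cons (V i) V : Fin (n + 1) → ℝ) 0 (V i) = Fin.cons (V i) V := by
    simp
  rw [h0] at h
  exact h

lemma measurePreserving_succAbove {n : ℕ} (j : Fin (n + 1)) :
    MeasurePreserving (fun U : Fin (n + 1) → ℝ => U ∘ j.succAbove) (unifPi (Fin (n + 1)))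
      (unifPi (Fin n)) :=
  measurePreserving_snd.comp (measurePreserving_piFinSuccAbove (fun _ : Fin (n + 1) => unif) j)

lemma measureReal_criticalPair {n : ℕ} {w : ℝ} (hw : 0 < w) (hw1 : w ≤ 1) {k : ℕ} (hk : 2 ≤ k)
    (j : Fin (n + 1)) (i : Fin n) :
    (unifPi (Fin (n + 1))).real (criticalPair w k (j.succAbove i) j) =
      (unifPi (Fin n)).real (criticalSet w k i) := by
  rw [← (measurePreserving_succAbove j).measureReal_preimage
    (measurableSet_criticalSet w k i).nullMeasurableSet]
  refine measureReal_congr ?_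
  filter_upwards [ae_generic w] with U hU
  have hV := hU.comp (Fin.succAbove_right_injective (p := j))
  exact propext ((mem_criticalPair_iff hw hw1 hk j i hV).trans
    (mem_criticalSet_iff hw hw1 hk i hV).symm)

lemma measureReal_doubled {n : ℕ} {w : ℝ} (hw1 : w ≤ 1) (k : ℕ)
    (j : Fin (n + 1)) (i : Fin n) :
    (unifPi (Fin (n + 1))).real {U | HasClique (fun a b =>
      Function.update U j (U (j.succAbove i)) a <
        Function.update U j (U (j.succAbove i)) b + w) k} =
      (unifPi (Fin n)).real (doubledSet w k i) := by
  rw [← (measurePreserving_succAbove j).measureReal_preimage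
    (measurableSet_doubledSet w k i).nullMeasurableSet]
  refine measureReal_congr ?_
  filter_upwards [ae_generic w] with U hU
  have hV := hU.comp (Fin.succAbove_right_injective (p := j))
  exact propext ((mem_doubled_iff hw1 k j i hV).trans (mem_doubledSet_iff hw1 k i hV).symm)

open Classical in
lemma nu_image {n : ℕ} {w : ℝ} {k : ℕ} {V : Fin n → ℝ} (hV : Function.Injective V) :
    nu w k (Finset.univ.image V) = ∑ i, if IsCritical w k V i then 1 else 0 := by
  unfold nu
  rw [Finset.sum_filter, Finset.sum_image hV.injOn, Finset.image_val_of_injOn hV.injOn]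
  refine Finset.sum_congr rfl fun i _ => ?_
  by_cases h : V i < 1 - w
  · simp [IsCritical, h]
  · simp [IsCritical, h]

open Classical in
/-- Doubling a point raises the scan statistic by at most one, so it is at least `k` afterwards if
and only if it was so before or the point is counted by `nuTilde`. -/
lemma nuTilde_image {n : ℕ} {w : ℝ} (hw1 : w ≤ 1) {k : ℕ} {V : Fin n → ℝ}
    (hV : Function.Injective V) :
    (nuTilde w k (Finset.univ.image V) : ℝ) +
      n * (if k ≤ scanStat w (Finset.univ.val.map V) then 1 else 0) =
      ∑ i, if k ≤ scanStat w (V i ::ₘ Finset.univ.val.map V) then 1 else 0 := by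
  unfold nuTilde
  rw [Finset.sum_image hV.injOn, Finset.image_val_of_injOn hV.injOn]
  push_cast
  have : (n : ℝ) * (if k ≤ scanStat w (Finset.univ.val.map V) then 1 else 0) =
      ∑ _i : Fin n, if k ≤ scanStat w (Finset.univ.val.map V) then 1 else 0 := by
    rw [Finset.sum_const, Finset.card_univ, Fintype.card_fin, nsmul_eq_mul]
  rw [this, ← Finset.sum_add_distrib]
  refine Finset.sum_congr rfl fun i _ => ?_
  have h1 := scanStat_le_cons hw1 (V i) (Finset.univ.val.map V)
  have h2 := scanStat_cons_le hw1 (V i) (Finset.univ.val.map V)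
  by_cases hk : k ≤ scanStat w (Finset.univ.val.map V)
  · rw [if_neg (by omega), if_pos hk, if_pos (by omega)]
    norm_num
  · by_cases hk' : k ≤ scanStat w (V i ::ₘ Finset.univ.val.map V)
    · rw [if_pos ⟨by omega, by omega⟩, if_neg hk, if_pos hk']
      norm_num
    · rw [if_neg (by omega), if_neg hk, if_neg hk']
      norm_num

section Expectation

variable {Ω : Type*} [MeasurableSpace Ω] {P : Measure Ω} [IsProbabilityMeasure P] {lam : ℝ≥0}
  {Pt : Ω → Finset ℝ}

lemma nu_le_card (w : ℝ) (k : ℕ) (s : Finset ℝ) : nu w k s ≤ s.card := by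
  classical
  unfold nu
  rw [Finset.sum_boole, Nat.cast_id]
  exact (Finset.card_filter_le _ _).trans (Finset.card_filter_le _ _)

lemma nuTilde_le_card (w : ℝ) (k : ℕ) (s : Finset ℝ) : nuTilde w k s ≤ s.card := by
  classical
  unfold nuTilde
  rw [Finset.sum_boole, Nat.cast_id]
  exact Finset.card_filter_le _ _

lemma IsPoissonProcess.integrable_nu_add_nuTilde (hPt : IsPoissonProcess P lam Pt)
    (hlam : 0 < lam) {w : ℝ} (hw : 0 < w) (hw1 : w ≤ 1) {k : ℕ} (hk : 2 ≤ k) (n : ℕ) :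
    Integrable (fun ω => (nu w k (Pt ω) : ℝ) + (nuTilde w k (Pt ω) : ℝ))
        (ProbabilityTheory.cond P {ω | (Pt ω).card = n}) ∧
      ∫ ω, ((nu w k (Pt ω) : ℝ) + (nuTilde w k (Pt ω) : ℝ))
          ∂(ProbabilityTheory.cond P {ω | (Pt ω).card = n}) =
        ∑ i : Fin n, (unifPi (Fin n)).real (criticalSet w k i) +
          ∑ i : Fin n, (unifPi (Fin n)).real (doubledSet w k i) - n * gamma P Pt w k n := by
  classical
  set A : Set (Fin n → ℝ) := {U | HasClique (fun a b => U a < U b + w) k} with hA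
  have hAm : MeasurableSet A := measurableSet_hasClique_lt measurable_id w k
  set g : (Fin n → ℝ) → ℝ := fun V => ∑ i : Fin n, (criticalSet w k i).indicator 1 V +
    ∑ i : Fin n, (doubledSet w k i).indicator 1 V - n * A.indicator 1 V with hg
  have hgm : Measurable g :=
    ((Finset.measurable_fun_sum _ fun i _ =>
      measurable_one.indicator (measurableSet_criticalSet w k i)).add
    (Finset.measurable_fun_sum _ fun i _ =>
      measurable_one.indicator (measurableSet_doubledSet w k i))).sub
    ((measurable_one.indicator hAm).const_mul _)
  have h := hPt.integral_cond hlam w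
    (f := fun s => (nu w k s : ℝ) + (nuTilde w k s : ℝ)) hgm (fun V hV => by
      have h1 := nuTilde_image hw1 (k := k) hV.injective
      rw [nu_image hV.injective]
      simp only [hg, Set.indicator_apply, mem_criticalSet_iff hw hw1 hk _ hV,
        mem_doubledSet_iff hw1 k _ hV, Pi.one_apply, ← h1, hA, Set.mem_ofPred_eq,
        ← le_scanStat_map_iff hw1 hV.mem_Ioc]
      push_cast
      ring)
  refine ⟨⟨h.1, ?_⟩, ?_⟩
  · have := cond_isProbabilityMeasure (hPt.measure_card_ne_zero hlam n)
    refine HasFiniteIntegral.of_bounded (C := (n : ℝ) + n) ?_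
    have hN : ∀ᵐ ω ∂(ProbabilityTheory.cond P {ω | (Pt ω).card = n}), (Pt ω).card = n :=
      ae_cond_mem (hPt.measurable_card (measurableSet_singleton n))
    filter_upwards [hN] with ω hω
    rw [Real.norm_of_nonneg (by positivity)]
    have h1 := nu_le_card w k (Pt ω)
    have h2 := nuTilde_le_card w k (Pt ω)
    rw [hω] at h1 h2
    exact add_le_add (by exact_mod_cast h1) (by exact_mod_cast h2)
  · have hint : ∀ {B : Set (Fin n → ℝ)}, MeasurableSet B →
        Integrable (B.indicator (1 : (Fin n → ℝ) → ℝ)) (unifPi (Fin n)) := fun hB =>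
      (integrable_const (1 : ℝ)).indicator hB
    rw [h.2, hPt.gamma_eq hlam hw1, hg, integral_sub, integral_add, integral_finsetSum,
      integral_finsetSum, integral_const_mul, integral_indicator_one hAm]
    · simp only [hA, integral_indicator_one (measurableSet_criticalSet w k _),
        integral_indicator_one (measurableSet_doubledSet w k _)]
    · exact fun i _ => hint (measurableSet_doubledSet w k i)
    · exact fun i _ => hint (measurableSet_criticalSet w k i)
    · exact integrable_finsetSum _ fun i _ => hint (measurableSet_criticalSet w k i)
    · exact integrable_finsetSum _ fun i _ => hint (measurableSet_doubledSet w k i)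
    · exact (integrable_finsetSum _ fun i _ => hint (measurableSet_criticalSet w k i)).add
        (integrable_finsetSum _ fun i _ => hint (measurableSet_doubledSet w k i))
    · exact (hint hAm).const_mul _

end Expectation

/-! ### The limit of the discretization error -/

lemma sum_filter_ne {n : ℕ} (f : Fin (n + 1) × Fin (n + 1) → ℝ) :
    ∑ x with x.1 ≠ x.2, f x = ∑ j, ∑ i : Fin n, f (j.succAbove i, j) := by
  rw [Finset.sum_filter, Fintype.sum_prod_type_right]
  refine Finset.sum_congr rfl fun j _ => ?_
  rw [Fin.sum_univ_succAbove _ j]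
  simp

/-- The pairs `i < j` and the pairs `j < i` describe the same event, so the limit is half the sum
over all ordered pairs. -/
lemma tendsto_measure_not_injective {q : ℕ} (hq : 0 < q) {w : ℝ} (hw : 0 < w) (hw1 : w ≤ 1)
    (k n : ℕ) :
    Tendsto (fun m : ℕ => ((m * q : ℕ) : ℝ) * (unifPi (Fin (n + 1))).real
        ({U | HasClique (fun a b => U a < U b + w) k} ∩
          {U | Function.Injective fun a => cell (m * q) (U a)}ᶜ)) atTop
      (𝓝 (1 / 2 * (n + 1) * ∑ i : Fin n, (unifPi (Fin n)).real (doubledSet w k i))) := by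
  set s₁ : Finset (Fin (n + 1) × Fin (n + 1)) := Finset.univ.filter fun x => x.1 < x.2 with hs₁
  set s₂ : Finset (Fin (n + 1) × Fin (n + 1)) := Finset.univ.filter fun x => x.2 < x.1 with hs₂
  have h1 := tendsto_measure_collision hq hw k (s := s₁)
    (fun x hx => (Finset.mem_filter.1 hx).2.ne)
    (fun x hx hx' => lt_asymm (Finset.mem_filter.1 hx).2 (Finset.mem_filter.1 hx').2)
  have h2 := tendsto_measure_collision hq hw k (s := s₂)
    (fun x hx => (Finset.mem_filter.1 hx).2.ne')
    (fun x hx hx' => lt_asymm (Finset.mem_filter.1 hx).2 (Finset.mem_filter.1 hx').2)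
  have e1 : ∀ m, ⋃ x ∈ s₁, {U : Fin (n + 1) → ℝ | cell (m * q) (U x.2) = cell (m * q) (U x.1)} =
      {U | Function.Injective fun a => cell (m * q) (U a)}ᶜ := by
    intro m
    ext U
    simp only [Set.mem_iUnion, hs₁, Finset.mem_filter, Finset.mem_univ, true_and,
      Set.mem_ofPred_eq, Set.mem_compl_iff, Function.Injective]
    constructor
    · rintro ⟨x, hx, h⟩ hinj
      exact hx.ne' (hinj h)
    · intro h
      push Not at h
      obtain ⟨a, b, hab, hne⟩ := h
      rcases lt_or_gt_of_ne hne with hlt | hlt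
      · exact ⟨(a, b), hlt, hab.symm⟩
      · exact ⟨(b, a), hlt, hab⟩
  have e2 : ∀ m, ⋃ x ∈ s₂, {U : Fin (n + 1) → ℝ | cell (m * q) (U x.2) = cell (m * q) (U x.1)} =
      {U | Function.Injective fun a => cell (m * q) (U a)}ᶜ := by
    intro m
    rw [← e1]
    ext U
    simp only [Set.mem_iUnion, hs₁, hs₂, Finset.mem_filter, Finset.mem_univ, true_and,
      Set.mem_ofPred_eq]
    constructor
    · rintro ⟨x, hx, h⟩
      exact ⟨x.swap, hx, h.symm⟩
    · rintro ⟨x, hx, h⟩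
      exact ⟨x.swap, hx, h.symm⟩
  simp only [e1] at h1
  simp only [e2] at h2
  have huniq := tendsto_nhds_unique h1 h2
  have hsum := sum_filter_ne fun x : Fin (n + 1) × Fin (n + 1) =>
    (unifPi (Fin (n + 1))).real {U | HasClique (fun a b =>
        Function.update U x.2 (U x.1) a < Function.update U x.2 (U x.1) b + w) k}
  have hsplit : (Finset.univ.filter fun x : Fin (n + 1) × Fin (n + 1) => x.1 ≠ x.2) = s₁ ∪ s₂ := by
    ext x
    simp [hs₁, hs₂]
  have hdisj : Disjoint s₁ s₂ := Finset.disjoint_filter.2 fun x _ h h' => lt_asymm h h'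
  rw [hsplit, Finset.sum_union hdisj, ← huniq] at hsum
  simp only [measureReal_doubled hw1 k, Finset.sum_const, Finset.card_univ, Fintype.card_fin,
    nsmul_eq_mul] at hsum
  convert h1 using 2
  push_cast at hsum
  linarith

lemma tendsto_measure_hiddenCluster {p q : ℕ} (hq : 0 < q) {w : ℝ} (hw : 0 < w) (hw1 : w ≤ 1)
    (hpw : w = (p : ℝ) / q) {k : ℕ} (hk : 2 ≤ k) (n : ℕ) :
    Tendsto (fun m : ℕ => ((m * q : ℕ) : ℝ) * (unifPi (Fin (n + 1))).real
        (hiddenCluster (Fin (n + 1)) w k (m * q) (m * p))) atTop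
      (𝓝 (1 / 2 * (n + 1) * ∑ i : Fin n, (unifPi (Fin n)).real (criticalSet w k i))) := by
  have hp : 0 < p := by
    rcases Nat.eq_zero_or_pos p with rfl | h
    · simp at hpw; exact absurd hpw hw.ne'
    · exact h
  have h := tendsto_measure_hidden hq hw hpw k
    (s := Finset.univ.filter fun x : Fin (n + 1) × Fin (n + 1) => x.1 ≠ x.2)
    (fun x hx => (Finset.mem_filter.1 hx).2)
  rw [sum_filter_ne fun x : Fin (n + 1) × Fin (n + 1) =>
    (unifPi (Fin (n + 1))).real (criticalPair w k x.1 x.2) * (1 / 2)] at h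
  simp only [measureReal_criticalPair hw hw1 hk, Finset.sum_const, Finset.card_univ,
    Fintype.card_fin, nsmul_eq_mul, ← Finset.sum_mul] at h
  have hlim : 1 / 2 * ((n : ℝ) + 1) * ∑ i : Fin n, (unifPi (Fin n)).real (criticalSet w k i) =
      ((n + 1 : ℕ) : ℝ) * ((∑ i : Fin n, (unifPi (Fin n)).real (criticalSet w k i)) * (1 / 2)) := by
    push_cast; ring
  rw [hlim]
  refine h.congr' ?_
  filter_upwards [eventually_gt_atTop 0] with m hm
  congr 1
  refine measureReal_congr ?_
  filter_upwards [ae_all_iff.2 fun i => ae_unifPi_eval ae_unif_mem i] with U hU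
  refine propext ⟨fun h => h.1, fun hF => ⟨hF, ?_⟩⟩
  obtain ⟨-, ⟨I, hkI, hI⟩, hno⟩ := hF
  have hN : 0 < m * q := Nat.mul_pos hm hq
  have hN' : (0 : ℝ) < (m * q : ℕ) := by exact_mod_cast hN
  have : ∃ a ∈ I, ∃ b ∈ I, ¬ cell (m * q) (U a) < cell (m * q) (U b) + m * p := by
    by_contra hcon
    push Not at hcon
    exact hno ⟨I, hkI, hcon⟩
  obtain ⟨a, ha, b, hb, hab⟩ := this
  have hlt := hI a ha b hb
  have h1 := lt_cell hN (hU a).1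
  have h2 := le_cell hN (hU b).1
  have h3 : ((m * q : ℕ) : ℝ) * w = (m * p : ℕ) := by
    rw [hpw, ← mul_div_mul_cast p hm, mul_div_cancel₀ _ hN'.ne']
  have h4 : ((m * q : ℕ) : ℝ) * U a < (m * q : ℕ) * U b + (m * p : ℕ) := by
    rw [← h3, ← mul_add]
    exact mul_lt_mul_of_pos_left hlt hN'
  have h5 : (cell (m * q) (U a) : ℝ) < cell (m * q) (U b) + 1 + (m * p : ℕ) := by linarith
  have h6 : cell (m * q) (U a) < cell (m * q) (U b) + 1 + m * p := by exact_mod_cast h5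
  have hmp : 0 < m * p := Nat.mul_pos hm hp
  have h7 : cell (m * q) (U a) = cell (m * q) (U b) + m * p := by omega
  have hne : b ≠ a := by
    rintro rfl
    omega
  refine Set.mem_iUnion.2 ⟨(b, a), Set.mem_iUnion.2 ⟨?_, h7⟩⟩
  exact Finset.mem_filter.2 ⟨Finset.mem_univ _, hne⟩

/-- A cluster of `k` points occurs with two points in one cell, or is seen by the discrete windows,
or is hidden. -/
lemma measureReal_hasClique_eq {p q m : ℕ} (hm : 0 < m) (hq : 0 < q) {w : ℝ}
    (hpw : w = (p : ℝ) / q) (k N : ℕ) :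
    (unifPi (Fin N)).real {U | HasClique (fun a b => U a < U b + w) k} =
      (unifPi (Fin N)).real ({U | HasClique (fun a b => U a < U b + w) k} ∩
          {U | Function.Injective fun a => cell (m * q) (U a)}ᶜ) +
      ((unifPi (Fin N)).real {U | Function.Injective (fun a => cell (m * q) (U a)) ∧
        HasClique (fun a b => cell (m * q) (U a) < cell (m * q) (U b) + m * p) k} +
      (unifPi (Fin N)).real (hiddenCluster (Fin N) w k (m * q) (m * p))) := by
  have hN : 0 < m * q := Nat.mul_pos hm hq
  have hN' : (0 : ℝ) < (m * q : ℕ) := by exact_mod_cast hN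
  have hI := measurableSet_injective_cell (ι := Fin N) (m * q)
  rw [← measureReal_inter_add_sdiff (s := {U : Fin N → ℝ |
    HasClique (fun a b => U a < U b + w) k}) hI, add_comm]
  congr 1
  rw [← measureReal_union]
  · refine measureReal_congr ?_
    filter_upwards [ae_all_iff.2 fun i => ae_unifPi_eval ae_unif_mem i] with U hU
    have hdisc : HasClique (fun a b => cell (m * q) (U a) < cell (m * q) (U b) + m * p) k →
        HasClique (fun a b => U a < U b + w) k := by
      rintro ⟨I, hkI, hI⟩
      refine ⟨I, hkI, fun a ha b hb => ?_⟩
      have h1 := le_cell hN (hU a).1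
      have h2 := lt_cell hN (hU b).1
      have h3 : ((m * q : ℕ) : ℝ) * w = (m * p : ℕ) := by
        rw [hpw, ← mul_div_mul_cast p hm, mul_div_cancel₀ _ hN'.ne']
      have h4 : (cell (m * q) (U a) : ℝ) + 1 ≤ cell (m * q) (U b) + (m * p : ℕ) := by
        exact_mod_cast hI a ha b hb
      refine lt_of_mul_lt_mul_left ?_ hN'.le
      rw [mul_add, h3]
      linarith
    refine propext ?_
    constructor
    · rintro ⟨h1, h2⟩
      by_cases h : HasClique (fun a b => cell (m * q) (U a) < cell (m * q) (U b) + m * p) k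
      · exact Or.inl ⟨h2, h⟩
      · exact Or.inr ⟨h2, h1, h⟩
    · rintro (⟨h1, h2⟩ | ⟨h1, h2, h3⟩)
      · exact ⟨hdisc h2, h1⟩
      · exact ⟨h2, h1⟩
  · refine Set.disjoint_left.2 ?_
    rintro U ⟨_, h⟩ ⟨_, _, h'⟩
    exact h' h
  · exact measurableSet_hiddenCluster w k _ _

/-- The limit for independent uniform points, before the sums over the sample are expressed by the
functionals `nu` and `nuTilde`. -/
theorem tendsto_gamma_sub_gammaDiscrete {p q : ℕ} (hq : 0 < q) (hpq : p ≤ q) {w : ℝ} (hw : 0 < w)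
    (hw1 : w ≤ 1) (hpw : w = (p : ℝ) / q) {k : ℕ} (hk : 2 ≤ k) (n : ℕ) :
    Tendsto (fun m : ℕ => ((m * q : ℕ) : ℝ) *
        ((unifPi (Fin (n + 1))).real {U | HasClique (fun a b => U a < U b + w) k} -
          gammaDiscrete (m * q) (m * p) k (n + 1))) atTop
      (𝓝 (1 / 2 * (n + 1) * ((∑ i : Fin n, (unifPi (Fin n)).real (doubledSet w k i)) +
        (∑ i : Fin n, (unifPi (Fin n)).real (criticalSet w k i)) -
        n * (unifPi (Fin (n + 1))).real {U | HasClique (fun a b => U a < U b + w) k}))) := by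
  set γ := (unifPi (Fin (n + 1))).real {U | HasClique (fun a b => U a < U b + w) k} with hγ
  have hc := tendsto_measure_not_injective hq hw hw1 k n
  have hh := tendsto_measure_hiddenCluster hq hw hw1 hpw hk n
  -- For `k = 0` every configuration has a cluster: this gives the probability of a collision.
  have h0 := tendsto_measure_not_injective hq hw hw1 0 n
  have hz : ∀ {ι : Type} (R : ι → ι → Prop), HasClique R 0 := fun R => ⟨∅, le_rfl, by simp⟩
  have hd : ∀ i : Fin n, doubledSet w 0 i = Set.univ := fun i =>
    Set.eq_univ_of_forall fun V => hz _
  simp only [hz, hd, Set.ofPred_true, Set.univ_inter, probReal_univ, Finset.sum_const,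
    Finset.card_univ, Fintype.card_fin, nsmul_eq_mul, mul_one] at h0
  have hn : Tendsto (fun m : ℕ => ((m * q : ℕ) : ℝ)) atTop atTop :=
    tendsto_natCast_atTop_atTop.comp (tendsto_id.atTop_mul_const' hq)
  have hcompl : ∀ m : ℕ, (unifPi (Fin (n + 1))).real
      {U | Function.Injective fun a => cell (m * q) (U a)}ᶜ =
      1 - (unifPi (Fin (n + 1))).real {U | Function.Injective fun a => cell (m * q) (U a)} :=
    fun m => probReal_compl_eq_one_sub (measurableSet_injective_cell _)
  have hD : Tendsto (fun m : ℕ => (unifPi (Fin (n + 1))).real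
      {U | Function.Injective fun a => cell (m * q) (U a)}) atTop (𝓝 1) := by
    have h1 := (h0.div_atTop hn).const_sub 1
    rw [sub_zero] at h1
    refine h1.congr' ?_
    filter_upwards [eventually_gt_atTop 0] with m hm
    have hN' : ((m * q : ℕ) : ℝ) ≠ 0 := by exact_mod_cast (Nat.mul_pos hm hq).ne'
    rw [mul_div_cancel_left₀ _ hN', hcompl]
    ring
  have hall := ((hc.add hh).sub (h0.const_mul γ)).div hD one_ne_zero
  rw [div_one] at hall
  have hlim : 1 / 2 * ((n : ℝ) + 1) * ((∑ i : Fin n, (unifPi (Fin n)).real (doubledSet w k i)) +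
      (∑ i : Fin n, (unifPi (Fin n)).real (criticalSet w k i)) - n * γ) =
      1 / 2 * (n + 1) * (∑ i : Fin n, (unifPi (Fin n)).real (doubledSet w k i)) +
      1 / 2 * (n + 1) * (∑ i : Fin n, (unifPi (Fin n)).real (criticalSet w k i)) -
      γ * (1 / 2 * (n + 1) * n) := by ring
  rw [hlim]
  refine hall.congr' ?_
  have hne : ∀ᶠ m : ℕ in atTop, (unifPi (Fin (n + 1))).real
      {U | Function.Injective fun a => cell (m * q) (U a)} ≠ 0 := hD.eventually_ne one_ne_zero
  have hlarge : ∀ᶠ m : ℕ in atTop, n + 1 ≤ m * q := by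
    filter_upwards [eventually_ge_atTop (n + 1)] with m hm
    exact hm.trans (Nat.le_mul_of_pos_right m hq)
  filter_upwards [eventually_gt_atTop 0, hne, hlarge] with m hm hm1 hm2
  have hN : 0 < m * q := Nat.mul_pos hm hq
  have hg := gammaDiscrete_mul (k := k) hN hm2 (Nat.mul_le_mul_left m hpq) (by omega)
  have hs := measureReal_hasClique_eq (p := p) hm hq hpw k (n + 1)
  rw [← hg] at hs
  rw [← hγ] at hs
  simp only [Pi.div_apply]
  rw [div_eq_iff hm1, hcompl]
  linear_combination -((m * q : ℕ) : ℝ) * hs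

end ScanStatistic

theorem theorem3p1 {Ω : Type*} [MeasurableSpace Ω] (P : Measure Ω) [IsProbabilityMeasure P]
    (lam : ℝ≥0) (hlam : 0 < lam) (Pt : Ω → Finset ℝ)
    (hPt : ScanStatistic.IsPoissonProcess P lam Pt)
    (p q : ℕ) (hp : 0 < p) (hpq : p < q) (hcop : Nat.Coprime p q)
    (w : ℝ) (hw : w = (p : ℝ) / (q : ℝ))
    (k N : ℕ) (hk : 2 ≤ k) (hN : k ≤ N) :
    Integrable
        (fun ω => (ScanStatistic.nu w k (Pt ω) : ℝ) + (ScanStatistic.nuTilde w k (Pt ω) : ℝ))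
        (ProbabilityTheory.cond P {ω | (Pt ω).card = N - 1}) ∧
      Tendsto
        (fun m : ℕ => ((m * q : ℕ) : ℝ) *
          (ScanStatistic.gamma P Pt w k N - ScanStatistic.gammaDiscrete (m * q) (m * p) k N))
        atTop
        (𝓝 ((1 / 2 : ℝ) * (N : ℝ) * ((N : ℝ) - 1) *
              (ScanStatistic.gamma P Pt w k (N - 1) - ScanStatistic.gamma P Pt w k N) +
            (1 / 2 : ℝ) * (N : ℝ) *
              ∫ ω, ((ScanStatistic.nu w k (Pt ω) : ℝ) + (ScanStatistic.nuTilde w k (Pt ω) : ℝ))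
                ∂(ProbabilityTheory.cond P {ω | (Pt ω).card = N - 1}))) := by
  obtain ⟨n, rfl⟩ : ∃ n, N = n + 1 := ⟨N - 1, by omega⟩
  have hq : 0 < q := hp.trans hpq
  have hq' : (0 : ℝ) < q := by exact_mod_cast hq
  have hw0 : 0 < w := by
    rw [hw]
    exact div_pos (by exact_mod_cast hp) hq'
  have hw1 : w ≤ 1 := by
    rw [hw, div_le_one hq']
    exact_mod_cast hpq.le
  rw [Nat.add_sub_cancel]
  obtain ⟨hint, hval⟩ := hPt.integrable_nu_add_nuTilde hlam hw0 hw1 hk n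
  refine ⟨hint, ?_⟩
  have h := ScanStatistic.tendsto_gamma_sub_gammaDiscrete hq hpq.le hw0 hw1 hw hk n
  rw [hval]
  rw [← hPt.gamma_eq hlam hw1] at h
  convert h using 2
  push_cast
  ring
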